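/- Let $M$ be a smooth manifold with two smooth complementary distributions $TM=\mathcal F\oplus\mathcal T$ of ranks $n_1,n_2$, equipped with smooth Euclidean fiber metrics $g_{\mathcal F}$, $g_{\mathcal T}$. For $u>0$ let $g_{M,u}=g_{\mathcal F}\oplus u^{-1}g_{\mathcal T}$ with Levi-Civita connection $\nabla^{g_{M,u}}$, let $\nabla^{\mathcal F,u}=P_{\mathcal F}\nabla^{g_{M,u}}P_{\mathcal F}$, $\nabla^{\mathcal T,u}=P_{\mathcal T}\nabla^{g_{M,u}}P_{\mathcal T}$, and put $$\iota_U\Omega_{\mathcal F}(Y,Z)=g_{\mathcal T}(U^{\mathcal T},[Z,Y]^{\mathcal T})\ \ (Y,Z\in\Gamma(\mathcal F)),\qquad \iota_X\Omega_{\mathcal T}(U,V)=g_{\mathcal F}(X^{\mathcal F},[V,U]^{\mathcal F})\ \ (U,V\in\Gamma(\mathcal T)),$$ with associated skew endomorphisms $\mathfrak{so}\Omega_{\mathcal F}$, $\mathfrak{so}\Omega_{\mathcal T}$ (so $g_{\mathcal F}(\mathfrak{so}\Omega_{\mathcal F}(U)Y,Z)=\iota_U\Omega_{\mathcal F}(Y,Z)$,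 and likewise for $\mathcal T$). Let $\nabla^{\mathcal F,0}=\nabla^{\mathcal F,u}-\frac{u^{-1}}2\mathfrak{so}\Omega_{\mathcal F}$ and $\nabla^{\mathcal T,0}=\nabla^{\mathcal T,u}-\frac u2\mathfrak{so}\Omega_{\mathcal T}$, which do not depend on $u$. Let $\iota_X\omega_u(Y,Z)=g_{M,u}(S_u(X)Y,Z)$, where $S_u=\nabla^{g_{M,u}}-\nabla^{\mathcal F,u}\oplus\nabla^{\mathcal T,u}$. Let $(E,h_E,\nabla^E)$ be a $\mathbb Z_2$-graded complex vector bundle with Hermitian metric and compatible even connection, with an odd, skew-adjoint Clifford action $c$ of $\mathcal F^*$, $c(\varphi)^2=-g_{\mathcal F}^*(\varphi,\varphi)$, such that $[\nabla^E_X,c(\varphi)]=c(\nabla^{\mathcal F,0}_X\varphi)$. On $E\otimes\wedge\mathcal T^*$ (graded tensor product) let $\varepsilon^{\mathcal T}_\psi$, $\iota^{\mathcal T}_f$ be exterior and interior multiplication, let $m_u(\varphi)=c(\varphi)$ for $\varphi\in\mathcal F^*$ and $m_u(\psi)=\varepsilon^{\mathcal T}_\psi-u\,\iota^{\mathcal T}_f$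 for $\psi=g_{\mathcal T}(f,\cdot)\in\mathcal T^*$, extend $m_u$ to two-forms by $m_u(\omega)=\frac12\sum\omega(b_i,b_j)m_u(b^i)m_u(b^j)$ (and define $c$ of a two-form on $\mathcal F$ in the same way), and set $$\nabla^{E,u}=\nabla^E+\tfrac{u^{-1}}4c(\Omega_{\mathcal F}),\qquad \nabla^{\mathbb E,u}=\nabla^{E,u}\otimes I+I\otimes\nabla^{\mathcal T,u}+\tfrac12m_u\omega_u,\qquad D_u=m_u\circ\nabla^{\mathbb E,u}.$$ Then the finite part $\mathbb D^E$ of $D_u$ as $u\to0^+$ (the limit that remains after subtracting finitely many terms $u^{-k}B_k$, $k\ge1$, with $B_k$ independent of $u$; convergence is pointwise on $M$, on each smooth section of $E\otimes\wedge\mathcal T^*$) exists and equals $$\mathbb D^E=D^{\mathcal F,E\otimes\wedge\mathcal T^*}+d^{\mathcal T}_{\nabla^E}+\tfrac14\iota^{\mathcal T}\circ c(\Omega_{\mathcal F})+\tfrac14\varepsilon^{\mathcal T}\circ\mathrm{tr}\,Lg_{\mathcal F}-\tfrac12c\circ\varepsilon^{\mathcal T}_{\Omega_{\mathcal T}}+\tfrac14c\circ\mathrm{tr}\,Lg_{\mathcal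 T},$$ where, for any orthonormal frames $e_i$ of $\mathcal F$ and $f_\mu$ of $\mathcal T$ with dual frames $\varphi^i$, $\psi^\mu$ (summation over repeated indices), $$D^{\mathcal F,E\otimes\wedge\mathcal T^*}=c(\varphi^i)(\nabla^E_{e_i}\otimes I+I\otimes\nabla^{\mathcal T,0}_{e_i}),\qquad d^{\mathcal T}_{\nabla^E}=\varepsilon^{\mathcal T}_{\psi^\mu}(\nabla^E_{f_\mu}\otimes I+I\otimes\nabla^{\mathcal T,0}_{f_\mu}),$$ $$\iota^{\mathcal T}\circ c(\Omega_{\mathcal F})=\tfrac12c(\varphi^i)c(\varphi^j)\iota^{\mathcal T}_{f_\mu}\,\iota_{f_\mu}\Omega_{\mathcal F}(e_i,e_j),\qquad \varepsilon^{\mathcal T}\circ\mathrm{tr}\,Lg_{\mathcal F}=\delta^{ij}\varepsilon^{\mathcal T}_{\psi^\mu}L_{f_\mu}g_{\mathcal F}(e_i,e_j),$$ $$c\circ\varepsilon^{\mathcal T}_{\Omega_{\mathcal T}}=\tfrac12c(\varphi^i)\varepsilon^{\mathcal T}_{\psi^\mu}\varepsilon^{\mathcal T}_{\psi^\nu}\,\iota_{e_i}\Omega_{\mathcal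 T}(f_\mu,f_\nu),\qquad c\circ\mathrm{tr}\,Lg_{\mathcal T}=\delta^{\mu\nu}c(\varphi^i)L_{e_i}g_{\mathcal T}(f_\mu,f_\nu).$$ -/

import Mathlib

open Bundle Module Filter Topology
open scoped Manifold ContDiff TensorProduct

noncomputable section

namespace AsymptoticBismut

/-! ### Finite parts -/

/-- `L` is the finite part, as `u → 0⁺`, of the one-parameter family `A u` of operators which send
elements of `Γ` (sections) to sections of the family of real vector spaces `V`: after subtraction of
finitely many terms `u⁻¹ B₀, u⁻² B₁, …` the family converges to `L`. Convergence is tested on every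
`σ : Γ`, at every point `x`, in the (finite-dimensional) fibre `V x`, i.e. against all linear
functionals. -/
def HasFinitePart {Γ M : Type*} {V : M → Type*} [∀ x, AddCommGroup (V x)] [∀ x, Module ℝ (V x)]
    (A : ℝ → Γ → Π x, V x) (L : Γ → Π x, V x) : Prop :=
  ∃ (N : ℕ) (B : Fin N → Γ → Π x, V x), ∀ (σ : Γ) (x : M) (l : Dual ℝ (V x)),
    Tendsto (fun u : ℝ => l (A u σ x - ∑ k : Fin N, (u ^ (k.val + 1))⁻¹ • B k σ x))
      (𝓝[>] 0) (𝓝 (l (L σ x)))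

/-- The finite part is unique. -/
theorem HasFinitePart.unique {Γ M : Type*} {V : M → Type*} [∀ x, AddCommGroup (V x)]
    [∀ x, Module ℝ (V x)] {A : ℝ → Γ → Π x, V x} {L L' : Γ → Π x, V x}
    (h : HasFinitePart A L) (h' : HasFinitePart A L') : L = L' := by
  obtain ⟨N, B, hB⟩ := h
  obtain ⟨N', B', hB'⟩ := h'
  funext σ x
  rw [← sub_eq_zero, ← Module.forall_dual_apply_eq_zero_iff ℝ]
  intro l
  let p : Polynomial ℝ :=
    (∑ k : Fin N', Polynomial.C (l (B' k σ x)) * Polynomial.X ^ (k.val + 1)) -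
      ∑ k : Fin N, Polynomial.C (l (B k σ x)) * Polynomial.X ^ (k.val + 1)
  have hp0 : p.coeff 0 = 0 := by
    simp [p, Polynomial.finsetSum_coeff]
  have h1 : Tendsto (fun u : ℝ => p.eval u⁻¹) (𝓝[>] 0) (𝓝 (l (L σ x) - l (L' σ x))) := by
    refine ((hB σ x l).sub (hB' σ x l)).congr fun u => ?_
    simp only [p, Polynomial.eval_sub, Polynomial.eval_finsetSum, Polynomial.eval_mul,
      Polynomial.eval_C, Polynomial.eval_pow, Polynomial.eval_X, map_sub, map_sum, map_smul,
      smul_eq_mul, inv_pow, mul_comm]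
    ring
  have h2 := h1.comp tendsto_inv_atTop_nhdsGT_zero
  have h3 : Tendsto (fun v : ℝ => p.eval v) atTop (𝓝 (l (L σ x) - l (L' σ x))) :=
    h2.congr fun v => by simp
  obtain ⟨hc, hd⟩ := (Polynomial.tendsto_nhds_iff p).1 h3
  rw [Polynomial.eq_C_of_degree_le_zero hd, hp0] at hc
  simpa using hc.symm

section Manifold

variable {n : ℕ} {M : Type*} [TopologicalSpace M] [ChartedSpace (EuclideanSpace ℝ (Fin n)) M]
  [IsManifold (𝓡 n) ∞ M]

/-- The tangent space of `M` at `x`. -/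
abbrev Tan (n : ℕ) {M : Type*} [TopologicalSpace M] [ChartedSpace (EuclideanSpace ℝ (Fin n)) M]
    (x : M) : Type :=
  TangentSpace (𝓡 n) x

instance (x : M) : FiniteDimensional ℝ (Tan n x) :=
  inferInstanceAs (FiniteDimensional ℝ (EuclideanSpace ℝ (Fin n)))

/-- A section `s` of the vector bundle `V` is smooth on `U`. -/
def SmoothOn (n : ℕ) {M : Type*} [TopologicalSpace M]
    [ChartedSpace (EuclideanSpace ℝ (Fin n)) M] (FV : Type*) [NormedAddCommGroup FV] [NormedSpace ℝ FV] {V : M → Type*}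
    [TopologicalSpace (TotalSpace FV V)] [∀ x, TopologicalSpace (V x)] [FiberBundle FV V]
    (s : Π x : M, V x) (U : Set M) : Prop :=
  ContMDiffOn (𝓡 n) ((𝓡 n).prod 𝓘(ℝ, FV)) ∞ (fun y => (⟨y, s y⟩ : TotalSpace FV V)) U

/-- A section `s` of the vector bundle `V` is differentiable at `x`. -/
def DiffAt (n : ℕ) {M : Type*} [TopologicalSpace M]
    [ChartedSpace (EuclideanSpace ℝ (Fin n)) M] (FV : Type*) [NormedAddCommGroup FV] [NormedSpace ℝ FV] {V : M → Type*}
    [TopologicalSpace (TotalSpace FV V)] [∀ x, TopologicalSpace (V x)] [FiberBundle FV V]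
    (s : Π x : M, V x) (x : M) : Prop :=
  MDifferentiableAt (𝓡 n) ((𝓡 n).prod 𝓘(ℝ, FV)) (fun y => (⟨y, s y⟩ : TotalSpace FV V)) x

/-- A vector field on `M` is smooth on `U`. -/
def SmoothVFOn (X : Π x : M, Tan n x) (U : Set M) : Prop :=
  SmoothOn n (EuclideanSpace ℝ (Fin n)) (V := fun x : M => TangentSpace (𝓡 n) x) X U

/-- A vector field on `M` is differentiable at `x`. -/
def DiffVFAt (X : Π x : M, Tan n x) (x : M) : Prop :=
  DiffAt n (EuclideanSpace ℝ (Fin n)) (V := fun x : M => TangentSpace (𝓡 n) x) X x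

/-! ### Levi-Civita connections -/

section LeviCivita

/-- `cov` is a Levi-Civita connection of the metric `g`: a torsion-free metric connection on `TM`.
As in Mathlib, `cov Y x v` is `∇_v Y` at `x`. -/
structure IsLeviCivita (g : ∀ x : M, Tan n x → Tan n x → ℝ)
    (cov : (Π x : M, Tan n x) → (Π x : M, Tan n x →L[ℝ] Tan n x)) : Prop where
  isCovariantDerivative :
    IsCovariantDerivativeOn (I := 𝓡 n) (M := M) (V := fun x : M => TangentSpace (𝓡 n) x)
      (EuclideanSpace ℝ (Fin n)) cov Set.univ
  torsion_free : ∀ (X Y : Π x : M, Tan n x) (x : M),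
    DiffVFAt X x → DiffVFAt Y x →
      cov Y x (X x) - cov X x (Y x) = VectorField.mlieBracket (𝓡 n) X Y x
  metric : ∀ (Y Z : Π x : M, Tan n x) (x : M) (v : Tan n x),
    DiffVFAt Y x → DiffVFAt Z x →
      mvfderiv (𝓡 n) (fun y => g y (Y y) (Z y)) x v
        = g x (cov Y x v) (Z x) + g x (Y x) (cov Z x v)

/-- The Levi-Civita connection of the metric `g`. By the fundamental theorem of Riemannian geometry,
it exists and is unique on differentiable vector fields, for every smooth Riemannian metric `g`. -/
def leviCivita (g : ∀ x : M, Tan n x → Tan n x → ℝ) :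
    (Π x : M, Tan n x) → (Π x : M, Tan n x →L[ℝ] Tan n x) :=
  Classical.epsilon (IsLeviCivita g)

end LeviCivita

/-! ### Distributions and fibre metrics -/

/-- `D` is a smooth distribution of rank `k`: locally it is spanned by `k` smooth pointwise linearly
independent vector fields. -/
def IsSmoothDistribution (k : ℕ) (D : ∀ x : M, Submodule ℝ (Tan n x)) : Prop :=
  ∀ x : M, ∃ U : Set M, IsOpen U ∧ x ∈ U ∧ ∃ e : Fin k → Π y : M, Tan n y,
    (∀ i, SmoothVFOn (e i) U) ∧
    ∀ y ∈ U, LinearIndependent ℝ (fun i => e i y) ∧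
      Submodule.span ℝ (Set.range fun i => e i y) = D y

/-- A section of the distribution `D` is smooth on `U`. -/
def SmoothFieldOn {D : ∀ x : M, Submodule ℝ (Tan n x)} (Y : Π x : M, D x) (U : Set M) : Prop :=
  SmoothVFOn (fun y => (Y y : Tan n y)) U

/-- `g` is a smooth Euclidean fibre metric on the distribution `D`. -/
structure IsFiberMetric (D : ∀ x : M, Submodule ℝ (Tan n x))
    (g : ∀ x : M, LinearMap.BilinForm ℝ (D x)) : Prop where
  symm : ∀ x v w, g x v w = g x w v
  pos : ∀ x v, v ≠ 0 → 0 < g x v v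
  smooth : ∀ (U : Set M) (Y Z : Π x : M, D x), IsOpen U → SmoothFieldOn Y U → SmoothFieldOn Z U →
    ContMDiffOn (𝓡 n) 𝓘(ℝ, ℝ) ∞ (fun y => g y (Y y) (Z y)) U

theorem IsFiberMetric.nondegenerate {D : ∀ x : M, Submodule ℝ (Tan n x)}
    {g : ∀ x : M, LinearMap.BilinForm ℝ (D x)} (h : IsFiberMetric D g) (x : M) :
    (g x).Nondegenerate := by
  constructor
  · intro v hv
    by_contra hne
    exact (h.pos x v hne).ne' (hv v)
  · intro v hv
    by_contra hne
    exact (h.pos x v hne).ne' (hv v)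

/-- Two transverse Euclidean distributions `TM = F ⊕ T` of ranks `n₁` and `n₂`. -/
structure Splitting (n n₁ n₂ : ℕ) (M : Type*) [TopologicalSpace M]
    [ChartedSpace (EuclideanSpace ℝ (Fin n)) M] [IsManifold (𝓡 n) ∞ M] where
  F : ∀ x : M, Submodule ℝ (Tan n x)
  T : ∀ x : M, Submodule ℝ (Tan n x)
  isCompl : ∀ x, IsCompl (F x) (T x)
  smoothF : IsSmoothDistribution n₁ F
  smoothT : IsSmoothDistribution n₂ T
  gF : ∀ x, LinearMap.BilinForm ℝ (F x)
  gT : ∀ x, LinearMap.BilinForm ℝ (T x)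
  metricF : IsFiberMetric F gF
  metricT : IsFiberMetric T gT

/-- The vector `w` with `g(w, ·) = l`, for a nondegenerate symmetric bilinear form `g`
and a linear functional `l`. -/
def raise {V : Type*} [AddCommGroup V] [Module ℝ V] [FiniteDimensional ℝ V]
    (g : LinearMap.BilinForm ℝ V) (hg : g.Nondegenerate) (l : V → ℝ) : V :=
  ∑ i, l (finBasis ℝ V i) • LinearMap.BilinForm.dualBasis g hg (finBasis ℝ V) i

/-- `transport x y` carries vectors at `x` to vectors at `y` with the same coordinates in the
preferred trivialization of `TM` around `x`. It is used to extend a vector `v` at `x` to the vector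
field `y ↦ transport x y v`, smooth near `x`. -/
def transport (x y : M) : Tan n x →ₗ[ℝ] Tan n y :=
  (trivializationAt (EuclideanSpace ℝ (Fin n)) (TangentSpace (𝓡 n) : M → Type) x).symmₗ ℝ y ∘ₗ
  (trivializationAt (EuclideanSpace ℝ (Fin n)) (TangentSpace (𝓡 n) : M → Type) x).linearMapAt ℝ x

theorem transport_eq_extend (x y : M) (v : Tan n x)
    (hy : y ∈ (trivializationAt (EuclideanSpace ℝ (Fin n))
      (TangentSpace (𝓡 n) : M → Type) x).baseSet) :
    transport x y v = FiberBundle.extend (EuclideanSpace ℝ (Fin n))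
      (E := (TangentSpace (𝓡 n) : M → Type)) v y := by
  simp only [transport, FiberBundle.extend, LinearMap.comp_apply]
  rw [Trivialization.coe_linearMapAt_of_mem _ (FiberBundle.mem_baseSet_trivializationAt' x)]
  exact congrFun (Trivialization.coe_symmₗ _ hy) _

namespace Splitting

variable {n₁ n₂ : ℕ} (S : Splitting n n₁ n₂ M)

/-- The projection `X ↦ X^F` of `TM` onto `F` along `T`. -/
def P (x : M) : Tan n x →ₗ[ℝ] S.F x := (S.F x).projectionOnto (S.T x) (S.isCompl x)

/-- The projection `X ↦ X^T` of `TM` onto `T` along `F`. -/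
def Q (x : M) : Tan n x →ₗ[ℝ] S.T x := (S.T x).projectionOnto (S.F x) (S.isCompl x).symm

/-- The metric `g_{M,u} = g_F ⊕ u⁻¹ g_T`. -/
def metric (u : ℝ) (x : M) (X Y : Tan n x) : ℝ :=
  S.gF x (S.P x X) (S.P x Y) + u⁻¹ * S.gT x (S.Q x X) (S.Q x Y)

/-- `transport`, projected to `F`. -/
def transportF (x y : M) : S.F x →ₗ[ℝ] S.F y := S.P y ∘ₗ transport x y ∘ₗ (S.F x).subtype

/-- `transport`, projected to `T`. -/
def transportT (x y : M) : S.T x →ₗ[ℝ] S.T y := S.Q y ∘ₗ transport x y ∘ₗ (S.T x).subtype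

/-- A vector `v ∈ F x` extended to a vector field which is tangent to `F` and smooth near `x`. -/
def extF {x : M} (v : S.F x) (y : M) : Tan n y := (S.transportF x y v : Tan n y)

/-- A vector `v ∈ T x` extended to a vector field which is tangent to `T` and smooth near `x`. -/
def extT {x : M} (v : S.T x) (y : M) : Tan n y := (S.transportT x y v : Tan n y)

/-- `ι_U Ω_F(Y, Z) = g_T(U^T, [Z, Y]^T)`, for `Y, Z ∈ F`. -/
def OmegaF (x : M) (U : Tan n x) (Y Z : S.F x) : ℝ :=
  S.gT x (S.Q x U) (S.Q x (VectorField.mlieBracket (𝓡 n) (S.extF Z) (S.extF Y) x))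

/-- `ι_X Ω_T(U, V) = g_F(X^F, [V, U]^F)`, for `U, V ∈ T`. -/
def OmegaT (x : M) (X : Tan n x) (U V : S.T x) : ℝ :=
  S.gF x (S.P x X) (S.P x (VectorField.mlieBracket (𝓡 n) (S.extT V) (S.extT U) x))

/-- The endomorphism `𝔰𝔬Ω_F(X)` of `F`: `g_F(𝔰𝔬Ω_F(X) Y, Z) = ι_X Ω_F(Y, Z)`. -/
def soF (x : M) (X : Tan n x) (Y : S.F x) : S.F x :=
  raise (S.gF x) (S.metricF.nondegenerate x) (S.OmegaF x X Y)

/-- The endomorphism `𝔰𝔬Ω_T(X)` of `T`: `g_T(𝔰𝔬Ω_T(X) U, V) = ι_X Ω_T(U, V)`. -/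
def soT (x : M) (X : Tan n x) (U : S.T x) : S.T x :=
  raise (S.gT x) (S.metricT.nondegenerate x) (S.OmegaT x X U)

/-- The Lie derivative `(L_V g_F)(X, Y) = V g_F(X, Y) - g_F([V, X]^F, Y) - g_F(X, [V, Y]^F)`,
for `V ∈ T` and `X, Y ∈ F`. -/
def lieF (x : M) (V : S.T x) (X Y : S.F x) : ℝ :=
  mvfderiv (𝓡 n) (fun y => S.gF y (S.transportF x y X) (S.transportF x y Y)) x (V : Tan n x)
    - S.gF x (S.P x (VectorField.mlieBracket (𝓡 n) (S.extT V) (S.extF X) x)) Y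
    - S.gF x X (S.P x (VectorField.mlieBracket (𝓡 n) (S.extT V) (S.extF Y) x))

/-- The Lie derivative `(L_X g_T)(U, V) = X g_T(U, V) - g_T([X, U]^T, V) - g_T(U, [X, V]^T)`,
for `X ∈ F` and `U, V ∈ T`. -/
def lieT (x : M) (X : S.F x) (U V : S.T x) : ℝ :=
  mvfderiv (𝓡 n) (fun y => S.gT y (S.transportT x y U) (S.transportT x y V)) x (X : Tan n x)
    - S.gT x (S.Q x (VectorField.mlieBracket (𝓡 n) (S.extF X) (S.extT U) x)) V
    - S.gT x U (S.Q x (VectorField.mlieBracket (𝓡 n) (S.extF X) (S.extT V) x))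

/-- The Levi-Civita connection of `g_{M,u}`. -/
def lc (u : ℝ) : (Π x : M, Tan n x) → (Π x : M, Tan n x →L[ℝ] Tan n x) := leviCivita (S.metric u)

/-- `∇^{F,u} = P_F ∇^{g_{M,u}} P_F`, on sections of `F`. -/
def connF (u : ℝ) (Y : Π y : M, S.F y) (x : M) (X : Tan n x) : S.F x :=
  S.P x (S.lc u (fun y => (Y y : Tan n y)) x X)

/-- `∇^{T,u} = P_T ∇^{g_{M,u}} P_T`, on sections of `T`. -/
def connT (u : ℝ) (U : Π y : M, S.T y) (x : M) (X : Tan n x) : S.T x :=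
  S.Q x (S.lc u (fun y => (U y : Tan n y)) x X)

/-- `∇^{F,0} = ∇^{F,u} - (u⁻¹/2) 𝔰𝔬Ω_F`, which does not depend on `u`; it is read off at `u = 1`. -/
def connF0 (Y : Π y : M, S.F y) (x : M) (X : Tan n x) : S.F x :=
  S.connF 1 Y x X - (1 / 2 : ℝ) • S.soF x X (Y x)

/-- `∇^{T,0} = ∇^{T,u} - (u/2) 𝔰𝔬Ω_T`, which does not depend on `u`; it is read off at `u = 1`. -/
def connT0 (U : Π y : M, S.T y) (x : M) (X : Tan n x) : S.T x :=
  S.connT 1 U x X - (1 / 2 : ℝ) • S.soT x X (U x)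

/-- `ι_X ω_u(Y, Z) = g_{M,u}(S_u(X) Y, Z)`, with the shape one-form
`S_u = ∇^{g_{M,u}} - ∇^{F,u} ⊕ ∇^{T,u}`. -/
def omega (u : ℝ) (x : M) (X Y Z : Tan n x) : ℝ :=
  S.metric u x
    (S.lc u (fun y => transport x y Y) x X
      - ((S.connF u (fun y => S.P y (transport x y Y)) x X : Tan n x)
        + (S.connT u (fun y => S.Q y (transport x y Y)) x X : Tan n x))) Z

/-- A section `φ` of `F^*` is smooth on `U`: it is smooth on smooth local sections of `F`. -/
def SmoothCoFieldOn (φ : Π x : M, Dual ℝ (S.F x)) (U : Set M) : Prop :=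
  ∀ (V : Set M) (Y : Π x : M, S.F x), IsOpen V → V ⊆ U → SmoothFieldOn Y V →
    ContMDiffOn (𝓡 n) 𝓘(ℝ, ℝ) ∞ (fun y => φ y (Y y)) V

/-- `θ = ∇^{F,0}_X φ` at `x`, for the connection on `F^*` dual to `∇^{F,0}`. -/
def IsDualDeriv0 (φ : Π x : M, Dual ℝ (S.F x)) (x : M) (X : Tan n x) (θ : Dual ℝ (S.F x)) : Prop :=
  ∀ (U : Set M) (Y : Π x : M, S.F x), IsOpen U → x ∈ U → SmoothFieldOn Y U →
    θ (Y x) = mvfderiv (𝓡 n) (fun y => φ y (Y y)) x X - φ x (S.connF0 Y x X)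

end Splitting

/-! ### Clifford modules -/

section Module

variable {n₁ n₂ : ℕ}
  (FE : Type*) [NormedAddCommGroup FE] [NormedSpace ℂ FE] [FiniteDimensional ℂ FE]
  (E : M → Type*) [TopologicalSpace (TotalSpace FE E)]
  [∀ x, AddCommGroup (E x)] [∀ x, Module ℂ (E x)] [∀ x, TopologicalSpace (E x)]
  [∀ x, IsTopologicalAddGroup (E x)] [∀ x, ContinuousSMul ℝ (E x)]
  [FiberBundle FE E] [VectorBundle ℝ FE E]

/-- (Complex linearity of the trivializations of `E` is a separate hypothesis `VectorBundle ℂ FE E`.)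
The structure of a `ℤ₂`-graded covariant Hermitian Clifford module
`(Cl(F^*, g_F^*), ∇^{F,0}) ↻ (E, h_E, ∇^E)` on the vector bundle `E`. -/
structure CliffordModule (S : Splitting n n₁ n₂ M) where
  /-- the Hermitian metric `h_E` -/
  h : ∀ x, E x →ₗ⋆[ℂ] E x →ₗ[ℂ] ℂ
  h_symm : ∀ x s t, (starRingEnd ℂ) (h x s t) = h x t s
  h_pos : ∀ x s, s ≠ 0 → 0 < (h x s s).re
  h_smooth : ∀ (U : Set M) (s t : Π x, E x), IsOpen U → SmoothOn n FE s U → SmoothOn n FE t U →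
    ContMDiffOn (𝓡 n) 𝓘(ℝ, ℂ) ∞ (fun y => h y (s y) (t y)) U
  /-- the `ℤ₂`-grading: `γ` is `1` on `E⁰` and `-1` on `E¹` -/
  γ : ∀ x, E x →ₗ[ℂ] E x
  γ_sq : ∀ x, γ x ∘ₗ γ x = LinearMap.id
  γ_smooth : ∀ (U : Set M) (s : Π x, E x), IsOpen U → SmoothOn n FE s U →
    SmoothOn n FE (fun y => γ y (s y)) U
  γ_h : ∀ x s t, h x (γ x s) (γ x t) = h x s t
  /-- the Clifford action of covectors -/
  c : ∀ x, Dual ℝ (S.F x) →ₗ[ℝ] (E x →ₗ[ℂ] E x)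
  /-- `c(φ)² = - g_F^*(φ, φ)`, where every covector is `φ = g_F(v, ·)` and
  `g_F^*(φ, φ) = g_F(v, v)` -/
  c_sq : ∀ x (v : S.F x), c x (S.gF x v) ∘ₗ c x (S.gF x v) = -(S.gF x v v) • LinearMap.id
  c_odd : ∀ x φ, γ x ∘ₗ c x φ = -(c x φ ∘ₗ γ x)
  c_skew : ∀ x φ s t, h x (c x φ s) t = -h x s (c x φ t)
  c_smooth : ∀ (U : Set M) (φ : Π x, Dual ℝ (S.F x)) (s : Π x, E x), IsOpen U →
    S.SmoothCoFieldOn φ U → SmoothOn n FE s U → SmoothOn n FE (fun y => c y (φ y) (s y)) U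
  /-- the connection `∇^E` -/
  conn : CovariantDerivative (𝓡 n) FE E
  conn_smooth : CovariantDerivative.ContMDiffCovariantDerivative conn ∞
  /-- `∇^E` is complex linear -/
  conn_I : ∀ (s : Π x, E x) (x : M) (X : Tan n x), DiffAt n FE s x →
    conn (fun y => Complex.I • s y) x X = Complex.I • conn s x X
  /-- `∇^E` preserves the grading -/
  conn_γ : ∀ (s : Π x, E x) (x : M) (X : Tan n x), DiffAt n FE s x →
    conn (fun y => γ y (s y)) x X = γ x (conn s x X)
  /-- `∇^E` is compatible with `h_E` -/
  conn_h : ∀ (s t : Π x, E x) (x : M) (X : Tan n x), DiffAt n FE s x → DiffAt n FE t x →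
    mvfderiv (𝓡 n) (fun y => h y (s y) (t y)) x X
      = h x (conn s x X) (t x) + h x (s x) (conn t x X)
  /-- `∇^E_X(c(φ) s) = c(∇^{F,0}_X φ) s + c(φ) ∇^E_X s` -/
  conn_c : ∀ (U : Set M) (φ : Π x, Dual ℝ (S.F x)) (s : Π x, E x) (x : M) (X : Tan n x)
    (θ : Dual ℝ (S.F x)), IsOpen U → x ∈ U → S.SmoothCoFieldOn φ U → SmoothOn n FE s U →
    S.IsDualDeriv0 φ x X θ →
    conn (fun y => c y (φ y) (s y)) x X = c x θ (s x) + c x (φ x) (conn s x X)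

variable {FE} {E} {S : Splitting n n₁ n₂ M}

instance (S : Splitting n n₁ n₂ M) (x : M) :
    FiniteDimensional ℝ (ExteriorAlgebra ℝ (Dual ℝ (S.T x))) :=
  Module.Finite.of_basis (finBasis ℝ (Dual ℝ (S.T x))).ExteriorAlgebra

/-- The fibre of `E ⊗ ∧T^*` at `x`. -/
abbrev Fib (E : M → Type*) [∀ x, AddCommGroup (E x)] [∀ x, Module ℂ (E x)]
    (S : Splitting n n₁ n₂ M) (x : M) :=
  E x ⊗[ℝ] ExteriorAlgebra ℝ (Dual ℝ (S.T x))

/-! ### Smooth sections of `E ⊗ ∧T^*` and tensor product connections -/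

/-- A section `σ` of `E ⊗ ∧T^*` written near `x` in the local trivializations of `E` and of `T`
around `x`, as a function with values in the fixed vector space `FE ⊗ ∧T_x^*`. -/
def localRep (FE : Type*) [NormedAddCommGroup FE] [NormedSpace ℂ FE]
    {E : M → Type*} [TopologicalSpace (TotalSpace FE E)]
    [∀ x, AddCommGroup (E x)] [∀ x, Module ℂ (E x)] [∀ x, TopologicalSpace (E x)]
    [FiberBundle FE E] [VectorBundle ℝ FE E] {S : Splitting n n₁ n₂ M}
    (σ : Π x, Fib E S x) (x y : M) :
    FE ⊗[ℝ] ExteriorAlgebra ℝ (Dual ℝ (S.T x)) :=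
  TensorProduct.map ((trivializationAt FE E x).linearMapAt ℝ y)
    (ExteriorAlgebra.map (S.transportT x y).dualMap).toLinearMap (σ y)

/-- The components of `localRep` in a basis of `FE ⊗ ∧T_x^*`. -/
def localComp (FE : Type*) [NormedAddCommGroup FE] [NormedSpace ℂ FE] [FiniteDimensional ℂ FE]
    {E : M → Type*} [TopologicalSpace (TotalSpace FE E)]
    [∀ x, AddCommGroup (E x)] [∀ x, Module ℂ (E x)] [∀ x, TopologicalSpace (E x)]
    [FiberBundle FE E] [VectorBundle ℝ FE E] {S : Splitting n n₁ n₂ M}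
    (σ : Π x, Fib E S x) (x : M)
    (i : Fin (finrank ℝ (FE ⊗[ℝ] ExteriorAlgebra ℝ (Dual ℝ (S.T x))))) (y : M) : ℝ :=
  (finBasis ℝ (FE ⊗[ℝ] ExteriorAlgebra ℝ (Dual ℝ (S.T x)))).repr (localRep FE σ x y) i

/-- A section of `E ⊗ ∧T^*` is smooth: its components in local trivializations are smooth. -/
def IsSmoothSection (FE : Type*) [NormedAddCommGroup FE] [NormedSpace ℂ FE] [FiniteDimensional ℂ FE]
    {E : M → Type*} [TopologicalSpace (TotalSpace FE E)]
    [∀ x, AddCommGroup (E x)] [∀ x, Module ℂ (E x)] [∀ x, TopologicalSpace (E x)]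
    [FiberBundle FE E] [VectorBundle ℝ FE E] {S : Splitting n n₁ n₂ M}
    (σ : Π x, Fib E S x) : Prop :=
  ∀ x i, ContMDiffAt (𝓡 n) 𝓘(ℝ, ℝ) ∞ (localComp FE σ x i) x

/-- The smooth sections `Γ(E ⊗ ∧T^*)`. -/
abbrev SmoothSec (FE : Type*) [NormedAddCommGroup FE] [NormedSpace ℂ FE] [FiniteDimensional ℂ FE]
    (E : M → Type*) [TopologicalSpace (TotalSpace FE E)]
    [∀ x, AddCommGroup (E x)] [∀ x, Module ℂ (E x)] [∀ x, TopologicalSpace (E x)]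
    [FiberBundle FE E] [VectorBundle ℝ FE E] (S : Splitting n n₁ n₂ M) :=
  {σ : Π x, Fib E S x // IsSmoothSection FE σ}

/-- The connection `∇^E ⊗ I + I ⊗ ∇^T` on `E ⊗ ∧T^*` determined by a connection `DE` on `E` and a
connection `DT` on `T` (which acts on `T^*` by duality and on `∧T^*` as a derivation). In the local
frames `e_a` of `E` and `t_ν` of `T` (dual frame `ψ^ν`) provided by the trivializations around `x`,
the three summands differentiate the components of `σ`, the frame of `E`, and the products
of the `ψ^ν`; the last is `- ∑ ψ^μ(∇_X t_ν) ε(ψ^ν) ι(t_μ)`. -/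
def tensorConn (FE : Type*) [NormedAddCommGroup FE] [NormedSpace ℂ FE] [FiniteDimensional ℂ FE]
    {E : M → Type*} [TopologicalSpace (TotalSpace FE E)]
    [∀ x, AddCommGroup (E x)] [∀ x, Module ℂ (E x)] [∀ x, TopologicalSpace (E x)]
    [FiberBundle FE E] [VectorBundle ℝ FE E] {S : Splitting n n₁ n₂ M}
    (DE : (Π y, E y) → Π x : M, Tan n x → E x)
    (DT : (Π y, S.T y) → Π x : M, Tan n x → S.T x)
    (σ : Π x, Fib E S x) (x : M) (X : Tan n x) : Fib E S x :=
  LinearMap.rTensor _ ((trivializationAt FE E x).symmₗ ℝ x)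
      (∑ i, mvfderiv (𝓡 n) (localComp FE σ x i) x X •
        finBasis ℝ (FE ⊗[ℝ] ExteriorAlgebra ℝ (Dual ℝ (S.T x))) i)
    + LinearMap.rTensor _
        ((finBasis ℝ FE).constr ℝ fun a =>
          DE (fun y => (trivializationAt FE E x).symmₗ ℝ y (finBasis ℝ FE a)) x X)
        (localRep FE σ x x)
    - ∑ μ, ∑ ν, (finBasis ℝ (S.T x)).coord μ
          (DT (fun y => S.transportT x y (finBasis ℝ (S.T x) ν)) x X) •
        LinearMap.lTensor (E x)
          (LinearMap.mulLeft ℝ (ExteriorAlgebra.ι ℝ ((finBasis ℝ (S.T x)).coord ν)) ∘ₗ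
            CliffordAlgebra.contractLeft (Dual.eval ℝ (S.T x) (finBasis ℝ (S.T x) μ)))
          (σ x)

/-! ### The family of Dirac operators -/

namespace CliffordModule

variable (C : CliffordModule FE E S)

/-- `c(φ) ⊗ I` on `E ⊗ ∧T^*`, for `φ ∈ F^*`. -/
def cl (x : M) (φ : Dual ℝ (S.F x)) : Fib E S x →ₗ[ℝ] Fib E S x :=
  LinearMap.rTensor _ ((C.c x φ).restrictScalars ℝ)

/-- The exterior product `ε^T_ψ` on `E ⊗ ∧T^*` (graded tensor product:
`ε_ψ (s ⊗ α) = (-1)^{|s|} s ⊗ ψ ∧ α`). -/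
def eps (x : M) (ψ : Dual ℝ (S.T x)) : Fib E S x →ₗ[ℝ] Fib E S x :=
  TensorProduct.map ((C.γ x).restrictScalars ℝ) (LinearMap.mulLeft ℝ (ExteriorAlgebra.ι ℝ ψ))

/-- The contraction `ι^T_f` on `E ⊗ ∧T^*` (graded tensor product:
`ι_f (s ⊗ α) = (-1)^{|s|} s ⊗ ι_f α`). -/
def iot (x : M) (f : S.T x) : Fib E S x →ₗ[ℝ] Fib E S x :=
  TensorProduct.map ((C.γ x).restrictScalars ℝ)
    (CliffordAlgebra.contractLeft (Dual.eval ℝ (S.T x) f))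

/-- `c^T_u(ψ) = ε^T_ψ - u ι^T_f`, where `ψ = g_T(f, ·)`. -/
def clT (u : ℝ) (x : M) (ψ : Dual ℝ (S.T x)) : Fib E S x →ₗ[ℝ] Fib E S x :=
  C.eps x ψ - u • C.iot x (raise (S.gT x) (S.metricT.nondegenerate x) ψ)

/-- The Clifford action `m_u(ξ)` of a covector `ξ ∈ T^*M = F^* ⊕ T^*`. -/
def m (u : ℝ) (x : M) (ξ : Dual ℝ (Tan n x)) : Fib E S x →ₗ[ℝ] Fib E S x :=
  C.cl x (ξ ∘ₗ (S.F x).subtype) + C.clT u x (ξ ∘ₗ (S.T x).subtype)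

/-- The Clifford action of a two-form `α` on `M`,
`m_u(α) = ½ ∑ α(b_i, b_j) m_u(b^i) m_u(b^j)` for any basis `b_i` of the tangent space. -/
def mTwo (u : ℝ) (x : M) (α : Tan n x → Tan n x → ℝ) : Fib E S x →ₗ[ℝ] Fib E S x :=
  (1 / 2 : ℝ) • ∑ i, ∑ j, α (finBasis ℝ (Tan n x) i) (finBasis ℝ (Tan n x) j) •
    (C.m u x ((finBasis ℝ (Tan n x)).coord i) ∘ₗ C.m u x ((finBasis ℝ (Tan n x)).coord j))

/-- `c(ι_X Ω_F) = ½ ∑ ι_X Ω_F(b_i, b_j) c(b^i) c(b^j)` on `E`, for any basis `b_i` of `F`. -/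
def cOmegaF (x : M) (X : Tan n x) : E x →ₗ[ℂ] E x :=
  (1 / 2 : ℝ) • ∑ i, ∑ j, S.OmegaF x X (finBasis ℝ (S.F x) i) (finBasis ℝ (S.F x) j) •
    (C.c x ((finBasis ℝ (S.F x)).coord i) ∘ₗ C.c x ((finBasis ℝ (S.F x)).coord j))

/-- `∇^{E,u} = ∇^E + (u⁻¹/4) c(Ω_F)`. -/
def connE (u : ℝ) (s : Π y, E y) (x : M) (X : Tan n x) : E x :=
  C.conn s x X + (u⁻¹ / 4) • C.cOmegaF x X (s x)

/-- `∇^{𝔼,u} = ∇^{E,u} ⊗ I + I ⊗ ∇^{T,u} + ½ m_u(ω_u)`. -/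
def bismutConn (u : ℝ) (σ : Π x, Fib E S x) (x : M) (X : Tan n x) : Fib E S x :=
  tensorConn FE (C.connE u) (S.connT u) σ x X
    + (1 / 2 : ℝ) • C.mTwo u x (S.omega u x X) (σ x)

/-- The Dirac operator `D_u = m_u ∘ ∇^{𝔼,u}`: `∑ m_u(b^i) ∇^{𝔼,u}_{b_i}` for any basis `b_i` of the
tangent space. -/
def dirac (u : ℝ) (σ : SmoothSec FE E S) (x : M) : Fib E S x :=
  ∑ i, C.m u x ((finBasis ℝ (Tan n x)).coord i)
    (C.bismutConn u σ.1 x (finBasis ℝ (Tan n x) i))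

/-! ### The terms of the global formula

They are written in bases `e` of `F x` and `f` of `T x`; dual bases are `e.coord`, `f.coord`. -/

section Terms

variable {x : M} (e : Basis (Fin n₁) ℝ (S.F x)) (f : Basis (Fin n₂) ℝ (S.T x))

/-- `∇^E ⊗ I + I ⊗ ∇^{T,0}`. -/
def conn0 (σ : SmoothSec FE E S) (x : M) (X : Tan n x) : Fib E S x :=
  tensorConn FE (fun s x X => C.conn s x X) S.connT0 σ.1 x X

/-- `D^{F,E⊗∧T^*} = c(φ^i) (∇^E_{e_i} ⊗ I + I ⊗ ∇^{T,0}_{e_i})`. -/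
def horizontalDirac (σ : SmoothSec FE E S) : Fib E S x :=
  ∑ i, C.cl x (e.coord i) (C.conn0 σ x (e i : Tan n x))

/-- `d^T_{∇^E} = ε^T_{ψ^μ} (∇^E_{f_μ} ⊗ I + I ⊗ ∇^{T,0}_{f_μ})`. -/
def transverseD (σ : SmoothSec FE E S) : Fib E S x :=
  ∑ μ, C.eps x (f.coord μ) (C.conn0 σ x (f μ : Tan n x))

/-- `ι^T ∘ c(Ω_F) = ½ c(φ^i) c(φ^j) ι^T_{f_μ} ι_{f_μ}Ω_F(e_i, e_j)`. -/
def iotaOmegaF : Fib E S x →ₗ[ℝ] Fib E S x :=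
  (1 / 2 : ℝ) • ∑ i, ∑ j, ∑ μ, S.OmegaF x (f μ : Tan n x) (e i) (e j) •
    (C.cl x (e.coord i) ∘ₗ C.cl x (e.coord j) ∘ₗ C.iot x (f μ))

/-- `ε^T ∘ tr Lg_F = δ^{ij} ε^T_{ψ^μ} L_{f_μ}g_F(e_i, e_j)`. -/
def epsTrLgF : Fib E S x →ₗ[ℝ] Fib E S x :=
  ∑ i, ∑ μ, S.lieF x (f μ) (e i) (e i) • C.eps x (f.coord μ)

/-- `c ∘ ε^T_{Ω_T} = ½ c(φ^i) ε^T_{ψ^μ} ε^T_{ψ^ν} ι_{e_i}Ω_T(f_μ, f_ν)`. -/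
def clEpsOmegaT : Fib E S x →ₗ[ℝ] Fib E S x :=
  (1 / 2 : ℝ) • ∑ i, ∑ μ, ∑ ν, S.OmegaT x (e i : Tan n x) (f μ) (f ν) •
    (C.cl x (e.coord i) ∘ₗ C.eps x (f.coord μ) ∘ₗ C.eps x (f.coord ν))

/-- `c ∘ tr Lg_T = δ^{μν} c(φ^i) L_{e_i}g_T(f_μ, f_ν)`. -/
def clTrLgT : Fib E S x →ₗ[ℝ] Fib E S x :=
  ∑ i, ∑ μ, S.lieT x (e i) (f μ) (f μ) • C.cl x (e.coord i)

end Terms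

end CliffordModule

end Module

end Manifold

end AsymptoticBismut

end

noncomputable section

namespace AsymptoticBismut

section

/-! ### Coefficients of a section in a local frame. -/

section LocalFrame

/-! The whole argument makes the dependence on `u` explicit. Since g_{M,u} puts the weight u⁻¹ on 𝒯
only, each term of Koszul's formula, evaluated on fields tangent to ℱ or to 𝒯, carries the factor 1
or u⁻¹. This gives ∇^{𝒯,u} = ∇^{𝒯,0} + (u/2) 𝔰𝔬Ω_𝒯 (`connT_transportT`). It also shows that ω_u has
only mixed ℱ-𝒯 components, which are combinations of L g_ℱ, u⁻¹Ω_ℱ, u⁻¹L g_𝒯 and Ω_𝒯 (`omega_F_F_T`,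
`omega_T_F_T`).

In a basis adapted to the splitting, D_u is the sum of c(φ^i)∇_{e_i} and (ε_μ - uι_μ)∇_{f_μ}. Its
first-order part gives D^ℱ + d^𝒯 up to terms of order u. The rest is an endomorphism of the fibre,
expanded in `clifford_expansion`. Against symmetric coefficients a product of two generators
collapses to a trace. For L g_ℱ this uses c² = -1. For L g_𝒯 it uses (ε - uι)² = -u, and this factor
u cancels the u⁻¹ in front. The form c(Ω_ℱ) enters with coefficient -u⁻¹/2 from ω_u and +u⁻¹/4 from
∇^{E,u}. The total -(u⁻¹/4) c(Ω_ℱ)(ε - uι) splits into the only singular term and the finite term ¼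
c(Ω_ℱ)ι. The Ω_𝒯 term is cubic, c·(ε - uι)·(ε - uι), and keeps only its εε part at u = 0. Hence D_u
= u⁻¹B + 𝔻 + uA + u²A' at every point (`exists_dirac_expansion`), and the finite part can be read
off.

The connection `leviCivita` is picked by a choice operator, so nothing can be said about it before
existence is known, on fields that are merely differentiable at a point (`exists_isLeviCivita`).
This requires g_{M,u}(Y, Z) to be differentiable for such fields, whereas the fibre metrics are only
assumed smooth on smooth sections. Expansion in a local frame closes the gap. -/

theorem MDifferentiableAt.finsetSum {E H M F : Type*} [NormedAddCommGroup E] [NormedSpace ℝ E]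
    [TopologicalSpace H] {I : ModelWithCorners ℝ E H} [TopologicalSpace M] [ChartedSpace H M]
    [NormedAddCommGroup F] [NormedSpace ℝ F] {ι : Type} {s : Finset ι} {f : ι → M → F} {x : M}
    (hf : ∀ i ∈ s, MDifferentiableAt I 𝓘(ℝ, F) (f i) x) :
    MDifferentiableAt I 𝓘(ℝ, F) (fun y => ∑ i ∈ s, f i y) x := by
  have h : MDifferentiableAt I 𝓘(ℝ, F) (∑ i ∈ s, f i) x :=
    MDifferentiableAt.sum (t := s) (f := f) hf
  simpa only [← Finset.sum_fn] using h

variable {E H M F : Type*} [NormedAddCommGroup E] [NormedSpace ℝ E] [TopologicalSpace H]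
  {I : ModelWithCorners ℝ E H} [TopologicalSpace M] [ChartedSpace H M]
  [NormedAddCommGroup F] [NormedSpace ℝ F]
  {V : M → Type*} [TopologicalSpace (TotalSpace F V)] [∀ x, AddCommGroup (V x)]
  [∀ x, Module ℝ (V x)] [∀ x, TopologicalSpace (V x)] [FiberBundle F V] [VectorBundle ℝ F V]
  [ContMDiffVectorBundle 1 F V I]

/-- The coefficients of a differentiable section in a `C¹` local frame are differentiable. -/
theorem mdifferentiableAt_coeff {ι : Type} [Fintype ι] {s : ι → (x : M) → V x} {u : Set M}
    {x : M} (hs : IsLocalFrameOn I F 1 s u) (hu : u ∈ 𝓝 x) {t : (x : M) → V x}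
    (ht : MDifferentiableAt I (I.prod 𝓘(ℝ, F)) (fun y => (⟨y, t y⟩ : TotalSpace F V)) x) (i : ι) :
    MDifferentiableAt I 𝓘(ℝ, ℝ) (fun y => hs.coeff i y (t y)) x := by
  classical
  set e := trivializationAt F V x
  have hxe : x ∈ e.baseSet := FiberBundle.mem_baseSet_trivializationAt' x
  have hxu : x ∈ u := mem_of_mem_nhds hu
  let p (j : ι) : F →L[ℝ] (ι → ℝ) →L[ℝ] F := ContinuousLinearMap.smulRightL ℝ (ι → ℝ) F
    (ContinuousLinearMap.proj (R := ℝ) (φ := fun _ : ι => ℝ) j)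
  -- In the trivialization the frame is a family of linear maps ℝ^ι → F, differentiable at `x`. The
  -- coefficients of `t` are the inverse of this family applied to the trivialized section, and
  -- inversion is differentiable at an invertible map.
  let φ : M → ((ι → ℝ) →L[ℝ] F) := fun y => ∑ j, p j (e ⟨y, s j y⟩).2
  have hφ : MDifferentiableAt I 𝓘(ℝ, (ι → ℝ) →L[ℝ] F) φ x := by
    refine MDifferentiableAt.finsetSum fun j _ => ?_
    have h1 : MDifferentiableAt I 𝓘(ℝ, F) (fun y => (e ⟨y, s j y⟩).2) x :=
      (e.mdifferentiableAt_section_iff I (s j) hxe).1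
        (((hs.contMDiffOn j).contMDiffAt hu).mdifferentiableAt one_ne_zero)
    exact (p j).mdifferentiableAt.comp x h1
  let ψ (y : M) (hy : y ∈ u) (hye : y ∈ e.baseSet) : (ι → ℝ) ≃L[ℝ] F :=
    ((hs.toBasisAt hy).equivFun.symm ≪≫ₗ e.linearEquivAt ℝ y hye).toContinuousLinearEquiv
  have hψ (y : M) (hy : y ∈ u) (hye : y ∈ e.baseSet) :
      (ψ y hy hye : (ι → ℝ) →L[ℝ] F) = φ y := by
    ext c
    simp [ψ, φ, p, Basis.equivFun_symm_apply]
  have hinv : MDifferentiableAt I 𝓘(ℝ, F →L[ℝ] (ι → ℝ))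
      (fun y => ContinuousLinearMap.inverse (φ y)) x := by
    have h1 : ContDiffAt ℝ 1 (ContinuousLinearMap.inverse : _ → F →L[ℝ] (ι → ℝ)) (φ x) := by
      rw [← hψ x hxu hxe]
      exact contDiffAt_map_inverse _
    exact (h1.differentiableAt one_ne_zero).mdifferentiableAt.comp x hφ
  have htv : MDifferentiableAt I 𝓘(ℝ, F) (fun y => (e ⟨y, t y⟩).2) x :=
    (e.mdifferentiableAt_section_iff I t hxe).1 ht
  have hmain : MDifferentiableAt I 𝓘(ℝ, ι → ℝ)
      (fun y => ContinuousLinearMap.inverse (φ y) (e ⟨y, t y⟩).2) x := hinv.clm_apply htv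
  have hcomp : MDifferentiableAt I 𝓘(ℝ, ℝ)
      (fun y => ContinuousLinearMap.inverse (φ y) (e ⟨y, t y⟩).2 i) x :=
    (ContinuousLinearMap.mdifferentiableAt
      (ContinuousLinearMap.proj (R := ℝ) (φ := fun _ : ι => ℝ) i)).comp x hmain
  refine hcomp.congr_of_eventuallyEq ?_
  filter_upwards [hu, e.open_baseSet.mem_nhds hxe] with y hy hye
  rw [← hψ y hy hye, ContinuousLinearMap.inverse_equiv]
  have : (e ⟨y, t y⟩).2 = ψ y hy hye (fun j => hs.coeff j y (t y)) := by
    have h : (hs.toBasisAt hy).equivFun.symm (fun j => hs.coeff j y (t y)) = t y := by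
      rw [LinearEquiv.symm_apply_eq]
      ext j
      simp [hy]
    change _ = e.linearEquivAt ℝ y hye ((hs.toBasisAt hy).equivFun.symm _)
    rw [h]
    rfl
  rw [this]
  simp

end LocalFrame


/-! ### Koszul's formula and existence of the Levi-Civita connection. -/

section Koszul

variable {n : ℕ} {M : Type*} [TopologicalSpace M] [ChartedSpace (EuclideanSpace ℝ (Fin n)) M]
  [IsManifold (𝓡 n) ∞ M]

/-- Pointwise nondegenerate symmetric forms on `TM`, differentiable on differentiable fields. -/
structure IsDiffMetric (G : ∀ x : M, LinearMap.BilinForm ℝ (Tan n x)) : Prop where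
  symm : ∀ x v w, G x v w = G x w v
  nondeg : ∀ x v, (∀ w, G x v w = 0) → v = 0
  diff : ∀ (Y Z : Π x : M, Tan n x) (x : M), DiffVFAt Y x → DiffVFAt Z x →
    MDifferentiableAt (𝓡 n) 𝓘(ℝ, ℝ) (fun y => G y (Y y) (Z y)) x

/-- The right-hand side of the Koszul formula. -/
def koszul (G : ∀ x : M, LinearMap.BilinForm ℝ (Tan n x)) (X Y Z : Π x : M, Tan n x) (x : M) : ℝ :=
  mvfderiv (𝓡 n) (fun y => G y (Y y) (Z y)) x (X x)
    + mvfderiv (𝓡 n) (fun y => G y (X y) (Z y)) x (Y x)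
    - mvfderiv (𝓡 n) (fun y => G y (X y) (Y y)) x (Z x)
    + G x (VectorField.mlieBracket (𝓡 n) X Y x) (Z x)
    - G x (VectorField.mlieBracket (𝓡 n) X Z x) (Y x)
    - G x (VectorField.mlieBracket (𝓡 n) Y Z x) (X x)

variable {G : ∀ x : M, LinearMap.BilinForm ℝ (Tan n x)} {x : M}
  {X X' Y Y' Z : Π x : M, Tan n x}

theorem DiffVFAt.add (hY : DiffVFAt Y x) (hZ : DiffVFAt Z x) : DiffVFAt (Y + Z) x :=
  mdifferentiableAt_add_section hY hZ

theorem DiffVFAt.smul {f : M → ℝ} (hf : MDifferentiableAt (𝓡 n) 𝓘(ℝ, ℝ) f x)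
    (hY : DiffVFAt Y x) : DiffVFAt (f • Y) x :=
  hf.smul_section hY

theorem IsDiffMetric.mvfderiv_add_left (hG : IsDiffMetric G) (hX : DiffVFAt X x) (hX' : DiffVFAt X' x)
    (hY : DiffVFAt Y x) (v : Tan n x) :
    mvfderiv (𝓡 n) (fun y => G y ((X + X') y) (Y y)) x v =
      mvfderiv (𝓡 n) (fun y => G y (X y) (Y y)) x v
        + mvfderiv (𝓡 n) (fun y => G y (X' y) (Y y)) x v := by
  simp only [Pi.add_apply, map_add, LinearMap.add_apply]
  rw [mvfderiv_fun_add (hG.diff _ _ _ hX hY) (hG.diff _ _ _ hX' hY)]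
  rfl

theorem IsDiffMetric.mvfderiv_smul_left (hG : IsDiffMetric G) {f : M → ℝ} (hf : MDifferentiableAt (𝓡 n) 𝓘(ℝ, ℝ) f x)
    (hX : DiffVFAt X x) (hY : DiffVFAt Y x) (v : Tan n x) :
    mvfderiv (𝓡 n) (fun y => G y ((f • X) y) (Y y)) x v =
      f x * mvfderiv (𝓡 n) (fun y => G y (X y) (Y y)) x v
        + mvfderiv (𝓡 n) f x v * G x (X x) (Y x) := by
  simp only [Pi.smul_apply', map_smul, LinearMap.smul_apply, smul_eq_mul]
  rw [mvfderiv_fun_mul hf (hG.diff _ _ _ hX hY)]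
  simp [mul_comm]

/-- Torsion-freeness in Koszul form. With `koszul_metric` it carries linearity from the first
argument to the other two, so that only the first needs a direct computation. -/
theorem koszul_symm (hs : ∀ x v w, G x v w = G x w v) :
    koszul G X Y Z x - koszul G Y X Z x = 2 * G x (VectorField.mlieBracket (𝓡 n) X Y x) (Z x) := by
  simp only [koszul, fun y => hs y (Y y) (X y)]
  rw [VectorField.mlieBracket_swap_apply (V := Y) (W := X)]
  simp only [map_neg, LinearMap.neg_apply]
  ring

theorem koszul_metric (hs : ∀ x v w, G x v w = G x w v) :
    koszul G X Y Z x + koszul G X Z Y x =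
      2 * mvfderiv (𝓡 n) (fun y => G y (Y y) (Z y)) x (X x) := by
  simp only [koszul, fun y => hs y (Z y) (Y y)]
  rw [VectorField.mlieBracket_swap_apply (V := Z) (W := Y)]
  simp only [map_neg, LinearMap.neg_apply]
  ring

theorem IsDiffMetric.koszul_add_left (hG : IsDiffMetric G) (hX : DiffVFAt X x) (hX' : DiffVFAt X' x)
    (hY : DiffVFAt Y x) (hZ : DiffVFAt Z x) :
    koszul G (X + X') Y Z x = koszul G X Y Z x + koszul G X' Y Z x := by
  simp only [koszul]
  rw [hG.mvfderiv_add_left hX hX' hY, hG.mvfderiv_add_left hX hX' hZ,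
    VectorField.mlieBracket_add_left hX hX', VectorField.mlieBracket_add_left hX hX']
  simp only [Pi.add_apply, map_add, LinearMap.add_apply]
  ring

theorem IsDiffMetric.koszul_smul_left (hG : IsDiffMetric G) {f : M → ℝ} (hf : MDifferentiableAt (𝓡 n) 𝓘(ℝ, ℝ) f x)
    (hX : DiffVFAt X x) (hY : DiffVFAt Y x) (hZ : DiffVFAt Z x) :
    koszul G (f • X) Y Z x = f x * koszul G X Y Z x := by
  simp only [koszul]
  rw [hG.mvfderiv_smul_left hf hX hY, hG.mvfderiv_smul_left hf hX hZ,
    VectorField.mlieBracket_smul_left hf hX, VectorField.mlieBracket_smul_left hf hX]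
  simp only [Pi.smul_apply', map_add, map_smul, map_neg, LinearMap.add_apply, LinearMap.neg_apply,
    LinearMap.smul_apply, smul_eq_mul, neg_smul]
  ring

theorem IsDiffMetric.koszul_add_middle (hG : IsDiffMetric G) (hX : DiffVFAt X x) (hY : DiffVFAt Y x)
    (hY' : DiffVFAt Y' x) (hZ : DiffVFAt Z x) :
    koszul G X (Y + Y') Z x = koszul G X Y Z x + koszul G X Y' Z x := by
  have h1 := koszul_symm (X := X) (Y := Y + Y') (Z := Z) (x := x) hG.symm
  have h2 := koszul_symm (X := X) (Y := Y) (Z := Z) (x := x) hG.symm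
  have h3 := koszul_symm (X := X) (Y := Y') (Z := Z) (x := x) hG.symm
  rw [hG.koszul_add_left hY hY' hX hZ, VectorField.mlieBracket_add_right hY hY'] at h1
  simp only [map_add, LinearMap.add_apply] at h1
  linarith

theorem IsDiffMetric.koszul_smul_middle (hG : IsDiffMetric G) {f : M → ℝ} (hf : MDifferentiableAt (𝓡 n) 𝓘(ℝ, ℝ) f x)
    (hX : DiffVFAt X x) (hY : DiffVFAt Y x) (hZ : DiffVFAt Z x) :
    koszul G X (f • Y) Z x =
      f x * koszul G X Y Z x + 2 * (mvfderiv (𝓡 n) f x (X x) * G x (Y x) (Z x)) := by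
  have h1 := koszul_symm (X := X) (Y := f • Y) (Z := Z) (x := x) hG.symm
  have h2 := koszul_symm (X := X) (Y := Y) (Z := Z) (x := x) hG.symm
  rw [hG.koszul_smul_left hf hY hX hZ, VectorField.mlieBracket_smul_right hf hY] at h1
  simp only [map_add, map_smul, LinearMap.add_apply, LinearMap.smul_apply, smul_eq_mul] at h1
  linear_combination h1 - f x * h2

theorem IsDiffMetric.koszul_add_right (hG : IsDiffMetric G) (hX : DiffVFAt X x) (hY : DiffVFAt Y x)
    (hZ : DiffVFAt Z x) (hY' : DiffVFAt Y' x) :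
    koszul G X Y (Z + Y') x = koszul G X Y Z x + koszul G X Y Y' x := by
  have h1 := koszul_metric (X := X) (Y := Z + Y') (Z := Y) (x := x) hG.symm
  have h2 := koszul_metric (X := X) (Y := Z) (Z := Y) (x := x) hG.symm
  have h3 := koszul_metric (X := X) (Y := Y') (Z := Y) (x := x) hG.symm
  rw [hG.koszul_add_middle hX hZ hY' hY, hG.mvfderiv_add_left hZ hY' hY] at h1
  linarith

theorem IsDiffMetric.koszul_smul_right (hG : IsDiffMetric G) {f : M → ℝ} (hf : MDifferentiableAt (𝓡 n) 𝓘(ℝ, ℝ) f x)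
    (hX : DiffVFAt X x) (hY : DiffVFAt Y x) (hZ : DiffVFAt Z x) :
    koszul G X Y (f • Z) x = f x * koszul G X Y Z x := by
  have h1 := koszul_metric (X := X) (Y := f • Z) (Z := Y) (x := x) hG.symm
  have h2 := koszul_metric (X := X) (Y := Z) (Z := Y) (x := x) hG.symm
  rw [hG.koszul_smul_middle hf hX hZ hY, hG.mvfderiv_smul_left hf hZ hY] at h1
  linear_combination h1 - f x * h2

/-- The Koszul expression is tensorial in `X` and `Z`, hence a bilinear form on the tangent space at
`x`, and nondegeneracy turns it into an endomorphism. -/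
theorem IsDiffMetric.exists_linear_koszul (hG : IsDiffMetric G) (hY : DiffVFAt Y x) :
    ∃ c : Tan n x →L[ℝ] Tan n x, ∀ X Z : Π x : M, Tan n x, DiffVFAt X x → DiffVFAt Z x →
      2 * G x (c (X x)) (Z x) = koszul G X Y Z x := by
  have h1 : ∀ Z : Π x : M, Tan n x, DiffVFAt Z x →
      TensorialAt (𝓡 n) (EuclideanSpace ℝ (Fin n)) (fun X => koszul G X Y Z x) x := fun Z hZ =>
    ⟨fun hf hX => hG.koszul_smul_left hf hX hY hZ, fun hX hX' => hG.koszul_add_left hX hX' hY hZ⟩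
  have h2 : ∀ X : Π x : M, Tan n x, DiffVFAt X x →
      TensorialAt (𝓡 n) (EuclideanSpace ℝ (Fin n)) (fun Z => koszul G X Y Z x) x := fun X hX =>
    ⟨fun hf hZ => hG.koszul_smul_right hf hX hY hZ, fun hZ hZ' => hG.koszul_add_right hX hY hZ hZ'⟩
  let B : Tan n x →L[ℝ] Tan n x →L[ℝ] ℝ :=
    TensorialAt.mkHom₂ (fun X Z => koszul G X Y Z x) x h1 h2
  have hB : ∀ X Z : Π x : M, Tan n x, DiffVFAt X x → DiffVFAt Z x →
      B (X x) (Z x) = koszul G X Y Z x := fun X Z hX hZ =>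
    TensorialAt.mkHom₂_apply h1 h2 hX hZ
  have hinj : Function.Injective (G x) := by
    rw [← LinearMap.ker_eq_bot, LinearMap.ker_eq_bot']
    intro v hv
    exact hG.nondeg x v fun w => by rw [hv]; rfl
  let g : Tan n x ≃ₗ[ℝ] Dual ℝ (Tan n x) :=
    LinearEquiv.ofInjectiveOfFinrankEq (G x) hinj (Subspace.dual_finrank_eq).symm
  let c : Tan n x →ₗ[ℝ] Tan n x :=
    g.symm.toLinearMap ∘ₗ ((1 / 2 : ℝ) • (ContinuousLinearMap.coeLM ℝ ∘ₗ B.toLinearMap))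
  have : T2Space (Tan n x) := inferInstanceAs (T2Space (EuclideanSpace ℝ (Fin n)))
  refine ⟨LinearMap.toContinuousLinearMap c, fun X Z hX hZ => ?_⟩
  have : G x (c (X x)) = (1 / 2 : ℝ) • (B (X x)).toLinearMap := by
    change g (g.symm _) = _
    rw [LinearEquiv.apply_symm_apply]
    rfl
  rw [← hB X Z hX hZ]
  change 2 * G x (c (X x)) (Z x) = _
  rw [this]
  simp

theorem exists_diffVF (v : Tan n x) : ∃ X : Π x : M, Tan n x, DiffVFAt X x ∧ X x = v :=
  ⟨FiberBundle.extend (EuclideanSpace ℝ (Fin n)) (E := (TangentSpace (𝓡 n) : M → Type)) v,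
    FiberBundle.mdifferentiableAt_extend .., by simp⟩

theorem IsDiffMetric.ext (hG : IsDiffMetric G) {v w : Tan n x}
    (h : ∀ Z : Π x : M, Tan n x, DiffVFAt Z x → G x v (Z x) = G x w (Z x)) : v = w := by
  rw [← sub_eq_zero]
  refine hG.nondeg x _ fun z => ?_
  obtain ⟨Z, hZ, rfl⟩ := exists_diffVF z
  simp [h Z hZ]

theorem IsDiffMetric.exists_isLeviCivita (hG : IsDiffMetric G) : ∃ cov, IsLeviCivita (fun x v w => G x v w) cov := by
  classical
  -- The value 0 at points where `Y` is not differentiable is harmless: every axiom of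
  -- `IsLeviCivita` is tested on fields differentiable at the point.
  let cov : (Π x : M, Tan n x) → (Π x : M, Tan n x →L[ℝ] Tan n x) := fun Y x =>
    if hY : DiffVFAt Y x then (hG.exists_linear_koszul hY).choose else 0
  have hcov (X Y Z : Π x : M, Tan n x) (x : M) (hX : DiffVFAt X x) (hY : DiffVFAt Y x)
      (hZ : DiffVFAt Z x) : 2 * G x (cov Y x (X x)) (Z x) = koszul G X Y Z x := by
    simp only [cov, dif_pos hY]
    exact (hG.exists_linear_koszul hY).choose_spec X Z hX hZ
  refine ⟨cov, ⟨?_, ?_⟩, ?_, ?_⟩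
  · intro Y Y' x hY hY' _
    ext1 v
    obtain ⟨X, hX, rfl⟩ := exists_diffVF v
    refine hG.ext fun Z hZ => ?_
    have h1 := hcov X (Y + Y') Z x hX (DiffVFAt.add hY hY') hZ
    have h2 := hcov X Y Z x hX hY hZ
    have h3 := hcov X Y' Z x hX hY' hZ
    rw [hG.koszul_add_middle hX hY hY' hZ] at h1
    simp only [add_apply, map_add, LinearMap.add_apply]
    linarith
  · intro Y f x hY hf _
    ext1 v
    obtain ⟨X, hX, rfl⟩ := exists_diffVF v
    refine hG.ext fun Z hZ => ?_
    have h1 := hcov X (f • Y) Z x hX (DiffVFAt.smul hf hY) hZ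
    have h2 := hcov X Y Z x hX hY hZ
    rw [hG.koszul_smul_middle hf hX hY hZ] at h1
    simp only [add_apply, map_add, LinearMap.add_apply,
      smul_apply, map_smul, LinearMap.smul_apply, smul_eq_mul,
      ContinuousLinearMap.smulRight_apply]
    linear_combination (1 / 2) * h1 - (1 / 2) * f x * h2
  · intro X Y x hX hY
    refine hG.ext fun Z hZ => ?_
    have h1 := hcov X Y Z x hX hY hZ
    have h2 := hcov Y X Z x hY hX hZ
    have h3 := koszul_symm (X := X) (Y := Y) (Z := Z) (x := x) hG.symm
    simp only [map_sub, LinearMap.sub_apply]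
    linarith
  · intro Y Z x v hY hZ
    obtain ⟨X, hX, rfl⟩ := exists_diffVF v
    have h1 := hcov X Y Z x hX hY hZ
    have h2 := hcov X Z Y x hX hZ hY
    have h3 := koszul_metric (X := X) (Y := Y) (Z := Z) (x := x) hG.symm
    rw [hG.symm x (Y x)]
    linarith

/-- Uniqueness: every Levi-Civita connection obeys the formula, so it does not matter which one the
choice operator returns. -/
theorem IsDiffMetric.koszul_formula (hG : IsDiffMetric G) {cov} (hcov : IsLeviCivita (fun x v w => G x v w) cov)
    (hX : DiffVFAt X x) (hY : DiffVFAt Y x) (hZ : DiffVFAt Z x) :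
    2 * G x (cov Y x (X x)) (Z x) = koszul G X Y Z x := by
  have m1 := hcov.metric Y Z x (X x) hY hZ
  have m2 := hcov.metric X Z x (Y x) hX hZ
  have m3 := hcov.metric X Y x (Z x) hX hY
  simp only [koszul]
  rw [m1, m2, m3, ← hcov.torsion_free X Y x hX hY, ← hcov.torsion_free X Z x hX hZ,
    ← hcov.torsion_free Y Z x hY hZ]
  simp only [map_sub, LinearMap.sub_apply, hG.symm x (Y x), hG.symm x (X x)]
  ring

end Koszul

end

/-! ### Adapted local frames and the metrics g_{M,u}. -/

section

namespace Splitting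

variable {n n₁ n₂ : ℕ} {M : Type*} [TopologicalSpace M]
  [ChartedSpace (EuclideanSpace ℝ (Fin n)) M] [IsManifold (𝓡 n) ∞ M] (S : Splitting n n₁ n₂ M)

/-- The splitting with the two distributions interchanged. -/
def swap : Splitting n n₂ n₁ M where
  F := S.T
  T := S.F
  isCompl x := (S.isCompl x).symm
  smoothF := S.smoothT
  smoothT := S.smoothF
  gF := S.gT
  gT := S.gF
  metricF := S.metricT
  metricT := S.metricF

variable {x : M}

@[simp] theorem P_coe (v : S.F x) : S.P x v = v := Submodule.projectionOnto_apply_left _ v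

@[simp] theorem P_coe_T (v : S.T x) : S.P x v = 0 := Submodule.projectionOnto_apply_right _ v

@[simp] theorem Q_coe (v : S.T x) : S.Q x v = v := S.swap.P_coe v

@[simp] theorem Q_coe_F (v : S.F x) : S.Q x v = 0 := S.swap.P_coe_T v

theorem P_add_Q (v : Tan n x) : (S.P x v : Tan n x) + (S.Q x v : Tan n x) = v := by
  exact Submodule.projection_add_projection_eq_self (S.isCompl x) v

/-- Replaces local spanning vector fields by globally defined sections of `D`, so that the fibre
metric can be evaluated on them. -/
theorem exists_smooth_sections {k : ℕ} {D : ∀ x : M, Submodule ℝ (Tan n x)}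
    (hD : IsSmoothDistribution k D) (x : M) : ∃ U : Set M, IsOpen U ∧ x ∈ U ∧
      ∃ e : Fin k → Π y : M, D y, (∀ i, SmoothFieldOn (e i) U) ∧ ∀ y ∈ U,
        LinearIndependent ℝ (fun i => (e i y : Tan n y)) ∧
          Submodule.span ℝ (Set.range fun i => (e i y : Tan n y)) = D y := by
  classical
  obtain ⟨U, hU, hx, e, he, h⟩ := hD x
  have hmem : ∀ y ∈ U, ∀ i, e i y ∈ D y := fun y hy i => by
    rw [← (h y hy).2]
    exact Submodule.subset_span ⟨i, rfl⟩
  -- Outside `U` the fields need not lie in `D`; the value there is irrelevant and set to 0.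
  let e' : Fin k → Π y : M, D y := fun i y => if hy : y ∈ U then ⟨e i y, hmem y hy i⟩ else 0
  have he' : ∀ y ∈ U, ∀ i, (e' i y : Tan n y) = e i y := fun y hy i => by simp [e', hy]
  refine ⟨U, hU, hx, e', fun i => ?_, fun y hy => ?_⟩
  · refine ContMDiffOn.congr (he i) fun y hy => ?_
    exact congrArg (TotalSpace.mk' _ y) (he' y hy i)
  · simp only [he' y hy]
    exact h y hy

theorem exists_frame (x : M) : ∃ U : Set M, IsOpen U ∧ x ∈ U ∧
    ∃ (e : Fin n₁ → Π y : M, S.F y) (t : Fin n₂ → Π y : M, S.T y),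
      (∀ i, SmoothFieldOn (e i) U) ∧ (∀ i, SmoothFieldOn (t i) U) ∧
      IsLocalFrameOn (𝓡 n) (EuclideanSpace ℝ (Fin n)) 1
        (V := fun y : M => TangentSpace (𝓡 n) y)
        (Sum.elim (fun i y => (e i y : Tan n y)) (fun i y => (t i y : Tan n y))) U := by
  obtain ⟨U, hU, hxU, e, he, h⟩ := exists_smooth_sections S.smoothF x
  obtain ⟨U', hU', hxU', t, ht, h'⟩ := exists_smooth_sections S.smoothT x
  have he' : ∀ i, SmoothFieldOn (e i) (U ∩ U') := fun i =>
    ContMDiffOn.mono (he i) Set.inter_subset_left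
  have ht' : ∀ i, SmoothFieldOn (t i) (U ∩ U') := fun i =>
    ContMDiffOn.mono (ht i) Set.inter_subset_right
  have hfun (y : M) : (fun a => Sum.elim (fun i y => (e i y : Tan n y))
      (fun i y => (t i y : Tan n y)) a y) =
      Sum.elim (fun i => (e i y : Tan n y)) (fun i => (t i y : Tan n y)) := by
    funext a
    cases a <;> rfl
  refine ⟨U ∩ U', hU.inter hU', ⟨hxU, hxU'⟩, e, t, he', ht', fun {y} hy => ?_, fun {y} hy => ?_,
    fun a => ?_⟩
  · rw [hfun]
    refine (h y hy.1).1.sum_type (h' y hy.2).1 ?_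
    rw [(h y hy.1).2, (h' y hy.2).2]
    exact (S.isCompl y).disjoint
  · rw [hfun, Set.Sum.elim_range, Submodule.span_union, (h y hy.1).2, (h' y hy.2).2]
    exact (S.isCompl y).sup_eq_top.ge
  · cases a with
    | inl i => exact ContMDiffOn.of_le (he' i) (by exact_mod_cast le_top)
    | inr i => exact ContMDiffOn.of_le (ht' i) (by exact_mod_cast le_top)

/-- A section of `F` is near `x` a combination of smooth sections, with coefficients that are
differentiable at `x`, if it is the `F`-part of a field differentiable at `x`. -/
theorem exists_coeff (x : M) : ∃ U : Set M, IsOpen U ∧ x ∈ U ∧ ∃ e : Fin n₁ → Π y : M, S.F y,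
    (∀ i, SmoothFieldOn (e i) U) ∧ ∀ Y : Π y : M, Tan n y, DiffVFAt Y x →
      ∃ c : Fin n₁ → M → ℝ, (∀ i, MDifferentiableAt (𝓡 n) 𝓘(ℝ, ℝ) (c i) x) ∧
        ∀ y ∈ U, S.P y (Y y) = ∑ i, c i y • e i y := by
  obtain ⟨U, hU, hxU, e, t, he, ht, hs⟩ := S.exists_frame x
  refine ⟨U, hU, hxU, e, he, fun Y hY => ⟨fun i y => hs.coeff (Sum.inl i) y (Y y),
    fun i => mdifferentiableAt_coeff hs (hU.mem_nhds hxU) hY _, fun y hy => ?_⟩⟩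
  have h := hs.coeff_sum_eq Y hy
  rw [Fintype.sum_sum_type] at h
  have h2 := congrArg (S.P y) h
  simpa only [map_add, map_sum, map_smul, Sum.elim_inl, Sum.elim_inr, P_coe, P_coe_T, smul_zero,
    Finset.sum_const_zero, add_zero] using h2

/-- Smoothness of the projection is not part of the data. It follows because `S.P` keeps exactly the
ℱ-coefficients in an adapted frame. Statements free of `u` pass from ℱ to 𝒯 through `swap`. -/
theorem diffVFAt_P {Y : Π y : M, Tan n y} (hY : DiffVFAt Y x) :
    DiffVFAt (fun y => (S.P y (Y y) : Tan n y)) x := by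
  obtain ⟨U, hU, hxU, e, he, h⟩ := S.exists_coeff x
  obtain ⟨c, hc, hcY⟩ := h Y hY
  have h1 : DiffVFAt (fun y => ∑ i, c i y • (e i y : Tan n y)) x :=
    MDifferentiableAt.sum_section fun i _ => (hc i).smul_section
      ((ContMDiffOn.contMDiffAt (he i) (hU.mem_nhds hxU)).mdifferentiableAt (by simp))
  refine MDifferentiableAt.congr_of_eventuallyEq h1 ?_
  filter_upwards [hU.mem_nhds hxU] with y hy
  rw [hcY y hy]
  simp

theorem diffVFAt_Q {Y : Π y : M, Tan n y} (hY : DiffVFAt Y x) :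
    DiffVFAt (fun y => (S.Q y (Y y) : Tan n y)) x := S.swap.diffVFAt_P hY

theorem mdifferentiableAt_gF {Y Z : Π y : M, Tan n y} (hY : DiffVFAt Y x) (hZ : DiffVFAt Z x) :
    MDifferentiableAt (𝓡 n) 𝓘(ℝ, ℝ) (fun y => S.gF y (S.P y (Y y)) (S.P y (Z y))) x := by
  obtain ⟨U, hU, hxU, e, he, h⟩ := S.exists_coeff x
  obtain ⟨c, hc, hcY⟩ := h Y hY
  obtain ⟨d, hd, hdZ⟩ := h Z hZ
  have h1 : MDifferentiableAt (𝓡 n) 𝓘(ℝ, ℝ)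
      (fun y => ∑ i, ∑ j, c i y * (d j y * S.gF y (e i y) (e j y))) x :=
    MDifferentiableAt.finsetSum fun i _ => MDifferentiableAt.finsetSum fun j _ =>
      (hc i).mul ((hd j).mul (((S.metricF.smooth U (e i) (e j) hU (he i) (he j)).contMDiffAt
        (hU.mem_nhds hxU)).mdifferentiableAt (by simp)))
  refine MDifferentiableAt.congr_of_eventuallyEq h1 ?_
  filter_upwards [hU.mem_nhds hxU] with y hy
  rw [hcY y hy, hdZ y hy]
  simp only [map_sum, map_smul, LinearMap.sum_apply, LinearMap.smul_apply, smul_eq_mul,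
    Finset.mul_sum]
  rw [Finset.sum_comm]
  refine Finset.sum_congr rfl fun i _ => Finset.sum_congr rfl fun j _ => ?_
  ring

/-- The bilinear form `g_{M,u}`. -/
def form (u : ℝ) (x : M) : LinearMap.BilinForm ℝ (Tan n x) :=
  (S.gF x).compl₁₂ (S.P x) (S.P x) + u⁻¹ • (S.gT x).compl₁₂ (S.Q x) (S.Q x)

theorem form_apply (u : ℝ) (v w : Tan n x) : S.form u x v w = S.metric u x v w := rfl

theorem form_eq (u : ℝ) (v w : Tan n x) : S.form u x v w =
    S.gF x (S.P x v) (S.P x w) + u⁻¹ * S.gT x (S.Q x v) (S.Q x w) := rfl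

theorem isDiffMetric_form {u : ℝ} (hu : 0 < u) : IsDiffMetric (S.form u) where
  symm x v w := by
    simp only [form_eq, S.metricF.symm x (S.P x v), S.metricT.symm x (S.Q x v)]
  nondeg x v h := by
    have h1 := h (S.P x v)
    have h2 := h (S.Q x v)
    simp only [form_eq, P_coe, P_coe_T, Q_coe, Q_coe_F, map_zero, mul_zero, add_zero, zero_add,
      mul_eq_zero, inv_eq_zero, hu.ne', false_or] at h1 h2
    have hP : S.P x v = 0 := by
      by_contra hne
      exact (S.metricF.pos x _ hne).ne' h1
    have hQ : S.Q x v = 0 := by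
      by_contra hne
      exact (S.metricT.pos x _ hne).ne' h2
    rw [← S.P_add_Q v, hP, hQ]
    simp
  diff Y Z x hY hZ := by
    simp only [form_eq]
    exact (S.mdifferentiableAt_gF hY hZ).add
      (mdifferentiableAt_const.mul (S.swap.mdifferentiableAt_gF hY hZ))

/-- The choice operator satisfies its defining property as soon as some connection does. -/
theorem isLeviCivita_lc {u : ℝ} (hu : 0 < u) :
    IsLeviCivita (fun x v w => S.form u x v w) (S.lc u) :=
  Classical.epsilon_spec (S.isDiffMetric_form hu).exists_isLeviCivita

theorem koszul_lc {u : ℝ} (hu : 0 < u) {X Y Z : Π y : M, Tan n y} (hX : DiffVFAt X x)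
    (hY : DiffVFAt Y x) (hZ : DiffVFAt Z x) :
    2 * S.form u x (S.lc u Y x (X x)) (Z x) = koszul (S.form u) X Y Z x :=
  (S.isDiffMetric_form hu).koszul_formula (S.isLeviCivita_lc hu) hX hY hZ

/-! ### Fields extending a vector -/

theorem transport_self (v : Tan n x) : transport x x v = v := by
  rw [transport_eq_extend x x v (FiberBundle.mem_baseSet_trivializationAt' x)]
  exact FiberBundle.extend_apply_self _ v

theorem diffVFAt_transport (v : Tan n x) : DiffVFAt (fun y => transport x y v) x := by
  have h : DiffVFAt (FiberBundle.extend (EuclideanSpace ℝ (Fin n))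
      (E := (TangentSpace (𝓡 n) : M → Type)) v) x := FiberBundle.mdifferentiableAt_extend ..
  refine MDifferentiableAt.congr_of_eventuallyEq h ?_
  filter_upwards [(trivializationAt (EuclideanSpace ℝ (Fin n))
      (TangentSpace (𝓡 n) : M → Type) x).open_baseSet.mem_nhds
      (FiberBundle.mem_baseSet_trivializationAt' x)] with y hy
  rw [transport_eq_extend x y v hy]

@[simp] theorem transportF_self (v : S.F x) : S.transportF x x v = v := by
  simp [transportF, transport_self]

@[simp] theorem transportT_self (v : S.T x) : S.transportT x x v = v := S.swap.transportF_self v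

theorem extF_self (v : S.F x) : S.extF v x = v := by simp [extF]

theorem extT_self (v : S.T x) : S.extT v x = v := by simp [extT]

theorem diffVFAt_extF (v : S.F x) : DiffVFAt (S.extF v) x :=
  S.diffVFAt_P (diffVFAt_transport (v : Tan n x))

theorem diffVFAt_extT (v : S.T x) : DiffVFAt (S.extT v) x := S.swap.diffVFAt_extF v

end Splitting

end

/-! ### Integrability forms, Lie derivatives, and the dependence of the connections on `u`. -/

section

/-- Linearity of `l` must be supplied: `raise` accepts any function and only reads its values on a
basis. -/
theorem raise_spec {V : Type*} [AddCommGroup V] [Module ℝ V] [FiniteDimensional ℝ V]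
    (g : LinearMap.BilinForm ℝ V) (hg : g.Nondegenerate) {l : V → ℝ} (hl : IsLinearMap ℝ l)
    (w : V) : g (raise g hg l) w = l w := by
  have h : g (raise g hg l) = hl.mk' l := by
    refine (finBasis ℝ V).ext fun j => ?_
    simp [raise, LinearMap.BilinForm.apply_dualBasis_left]
  rw [h]
  rfl

namespace Splitting

variable {n n₁ n₂ : ℕ} {M : Type*} [TopologicalSpace M]
  [ChartedSpace (EuclideanSpace ℝ (Fin n)) M] [IsManifold (𝓡 n) ∞ M] (S : Splitting n n₁ n₂ M)
  {x : M}

theorem extF_add (v w : S.F x) : S.extF (v + w) = S.extF v + S.extF w := by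
  funext y
  simp [extF]

theorem extF_smul (a : ℝ) (v : S.F x) : S.extF (a • v) = a • S.extF v := by
  funext y
  simp [extF]

theorem isLinearMap_OmegaF_left (Y Z : S.F x) : IsLinearMap ℝ fun U => S.OmegaF x U Y Z where
  map_add U V := by simp [OmegaF]
  map_smul a U := by simp [OmegaF]

theorem isLinearMap_OmegaF (U : Tan n x) (Y : S.F x) : IsLinearMap ℝ (S.OmegaF x U Y) where
  map_add Z Z' := by
    simp only [OmegaF, extF_add]
    rw [VectorField.mlieBracket_add_left (S.diffVFAt_extF Z) (S.diffVFAt_extF Z')]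
    simp
  map_smul a Z := by
    simp only [OmegaF, extF_smul]
    rw [VectorField.mlieBracket_const_smul_left (S.diffVFAt_extF Z)]
    simp

theorem OmegaF_swap (U : Tan n x) (Y Z : S.F x) : S.OmegaF x U Y Z = -S.OmegaF x U Z Y := by
  simp only [OmegaF]
  rw [VectorField.mlieBracket_swap_apply]
  simp

theorem OmegaF_coe_F (X Y Z : S.F x) : S.OmegaF x (X : Tan n x) Y Z = 0 := by simp [OmegaF]

theorem isLinearMap_OmegaT (U : Tan n x) (Y : S.T x) : IsLinearMap ℝ (S.OmegaT x U Y) :=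
  S.swap.isLinearMap_OmegaF U Y

theorem OmegaT_swap (U : Tan n x) (Y Z : S.T x) : S.OmegaT x U Y Z = -S.OmegaT x U Z Y :=
  S.swap.OmegaF_swap U Y Z

theorem OmegaT_coe_T (X Y Z : S.T x) : S.OmegaT x (X : Tan n x) Y Z = 0 :=
  S.swap.OmegaF_coe_F X Y Z

theorem lieF_symm (V : S.T x) (X Y : S.F x) : S.lieF x V X Y = S.lieF x V Y X := by
  simp only [lieF, fun y => S.metricF.symm y (S.transportF x y X) (S.transportF x y Y),
    S.metricF.symm x X, S.metricF.symm x _ Y]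
  ring

theorem lieT_symm (X : S.F x) (U V : S.T x) : S.lieT x X U V = S.lieT x X V U :=
  S.swap.lieF_symm X U V

theorem gT_soT (X : Tan n x) (U V : S.T x) : S.gT x (S.soT x X U) V = S.OmegaT x X U V :=
  raise_spec _ _ (S.isLinearMap_OmegaT X U) V

theorem gT_ext {v w : S.T x} (h : ∀ z, S.gT x v z = S.gT x w z) : v = w := by
  rw [← sub_eq_zero]
  by_contra hne
  refine (S.metricT.pos x _ hne).ne' ?_
  rw [map_sub (S.gT x) v w, LinearMap.sub_apply, h, sub_self]

theorem soT_coe_T (X U : S.T x) : S.soT x (X : Tan n x) U = 0 :=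
  S.gT_ext fun z => by simp [gT_soT, OmegaT_coe_T]

theorem mvfderiv_const_mul {f : M → ℝ} (hf : MDifferentiableAt (𝓡 n) 𝓘(ℝ, ℝ) f x) (a : ℝ)
    (v : Tan n x) : mvfderiv (𝓡 n) (fun y => a * f y) x v = a * mvfderiv (𝓡 n) f x v := by
  rw [mvfderiv_fun_mul mdifferentiableAt_const hf]
  simp [mvfderiv_const]

@[simp] theorem P_extF (v : S.F x) (y : M) : S.P y (S.extF v y) = S.transportF x y v := S.P_coe _

@[simp] theorem Q_extF (v : S.F x) (y : M) : S.Q y (S.extF v y) = 0 := S.Q_coe_F _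

@[simp] theorem P_extT (v : S.T x) (y : M) : S.P y (S.extT v y) = 0 := S.P_coe_T _

@[simp] theorem Q_extT (v : S.T x) (y : M) : S.Q y (S.extT v y) = S.transportT x y v := S.Q_coe _

theorem mdifferentiableAt_gT {Y Z : Π y : M, Tan n y} (hY : DiffVFAt Y x) (hZ : DiffVFAt Z x) :
    MDifferentiableAt (𝓡 n) 𝓘(ℝ, ℝ) (fun y => S.gT y (S.Q y (Y y)) (S.Q y (Z y))) x :=
  S.swap.mdifferentiableAt_gF hY hZ

/-- With two arguments tangent to 𝒯, the only term that sees g_ℱ is the one pairing their bracket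
with `X`, and that term is Ω_𝒯. All others carry u⁻¹. -/
theorem exists_koszul_extT {X : Π y : M, Tan n y} (hX : DiffVFAt X x) (v w : S.T x) :
    ∃ K : ℝ, ∀ u : ℝ, koszul (S.form u) X (S.extT v) (S.extT w) x
      = u⁻¹ * K + S.OmegaT x (X x) v w := by
  have hv := S.diffVFAt_extT v
  have hw := S.diffVFAt_extT w
  refine ⟨mvfderiv (𝓡 n) (fun y => S.gT y (S.Q y (S.extT v y)) (S.Q y (S.extT w y))) x (X x)
    + mvfderiv (𝓡 n) (fun y => S.gT y (S.Q y (X y)) (S.Q y (S.extT w y))) x v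
    - mvfderiv (𝓡 n) (fun y => S.gT y (S.Q y (X y)) (S.Q y (S.extT v y))) x w
    + S.gT x (S.Q x (VectorField.mlieBracket (𝓡 n) X (S.extT v) x)) w
    - S.gT x (S.Q x (VectorField.mlieBracket (𝓡 n) X (S.extT w) x)) v
    - S.gT x (S.Q x (VectorField.mlieBracket (𝓡 n) (S.extT v) (S.extT w) x)) (S.Q x (X x)),
    fun u => ?_⟩
  simp only [koszul, form_eq, P_extT, map_zero, zero_add, OmegaT]
  rw [mvfderiv_const_mul (S.mdifferentiableAt_gT hv hw),
    mvfderiv_const_mul (S.mdifferentiableAt_gT hX hw),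
    mvfderiv_const_mul (S.mdifferentiableAt_gT hX hv),
    VectorField.mlieBracket_swap_apply (V := S.extT w) (W := S.extT v), S.metricF.symm x (S.P x (X x))]
  simp only [extT_self, Q_extT, Q_coe, map_neg, LinearMap.neg_apply]
  ring

/-- After multiplication by `u`, Koszul's formula for the 𝒯-part reads K + uΩ_𝒯 with K independent
of `u`. Comparison with `u = 1`, where ∇^{𝒯,0} is defined, gives the claim. -/
theorem connT_transportT {u : ℝ} (hu : 0 < u) (v : S.T x) (X : Tan n x) :
    S.connT u (fun y => S.transportT x y v) x X =
      S.connT0 (fun y => S.transportT x y v) x X + (u / 2) • S.soT x X v := by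
  refine S.gT_ext fun w => ?_
  obtain ⟨X, hX, rfl⟩ := exists_diffVF X
  obtain ⟨K, hK⟩ := S.exists_koszul_extT hX v w
  have hv := S.diffVFAt_extT v
  have hw := S.diffVFAt_extT w
  have key : ∀ u : ℝ, 0 < u → 2 * S.gT x (S.connT u (fun y => S.transportT x y v) x (X x)) w =
      K + u * S.OmegaT x (X x) v w := fun u hu => by
    have h := S.koszul_lc hu hX hv hw
    rw [hK u, form_eq] at h
    simp only [P_extT, map_zero, zero_add, Q_extT, transportT_self] at h
    change 2 * (u⁻¹ * S.gT x (S.connT u (fun y => S.transportT x y v) x (X x)) w) = _ at h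
    field_simp at h
    linarith
  have h1 := key u hu
  have h2 := key 1 one_pos
  simp only [connT0, transportT_self, map_add, map_sub, map_smul, LinearMap.add_apply,
    LinearMap.sub_apply, LinearMap.smul_apply, smul_eq_mul, gT_soT]
  linarith

/-! ### The shape form -/

theorem diffVFAt_P_transport (Y : Tan n x) :
    DiffVFAt (fun y => (S.P y (transport x y Y) : Tan n y)) x :=
  S.diffVFAt_P (diffVFAt_transport Y)

theorem diffVFAt_Q_transport (Y : Tan n x) :
    DiffVFAt (fun y => (S.Q y (transport x y Y) : Tan n y)) x :=
  S.diffVFAt_Q (diffVFAt_transport Y)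

/-- Subtracting the two diagonal blocks leaves the off-diagonal part Q∇P + P∇Q of the connection. -/
theorem omega_eq {u : ℝ} (hu : 0 < u) (X Y Z : Tan n x) : S.omega u x X Y Z =
    S.form u x
      ((S.Q x (S.lc u (fun y => (S.P y (transport x y Y) : Tan n y)) x X) : Tan n x)
        + (S.P x (S.lc u (fun y => (S.Q y (transport x y Y) : Tan n y)) x X) : Tan n x)) Z := by
  have h : (fun y => transport x y Y) = (fun y => (S.P y (transport x y Y) : Tan n y))
      + fun y => (S.Q y (transport x y Y) : Tan n y) := by
    funext y
    exact (S.P_add_Q _).symm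
  have hadd := (S.isLeviCivita_lc hu).isCovariantDerivative.add (S.diffVFAt_P_transport Y)
    (S.diffVFAt_Q_transport Y)
  simp only [omega, connF, connT, ← form_apply]
  congr 2
  conv_lhs => rw [h, hadd]
  rw [add_apply]
  have h1 := S.P_add_Q (S.lc u (fun y => (S.P y (transport x y Y) : Tan n y)) x X)
  have h2 := S.P_add_Q (S.lc u (fun y => (S.Q y (transport x y Y) : Tan n y)) x X)
  nth_rewrite 1 [← h1, ← h2]
  abel

theorem isLinearMap_omega_left {u : ℝ} (hu : 0 < u) (Y Z : Tan n x) :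
    IsLinearMap ℝ fun X => S.omega u x X Y Z where
  map_add X X' := by
    simp only [S.omega_eq hu, map_add, Submodule.coe_add, LinearMap.add_apply]
    ring
  map_smul a X := by
    simp only [S.omega_eq hu, map_add, map_smul, Submodule.coe_smul, LinearMap.add_apply,
      LinearMap.smul_apply, smul_eq_mul]
    ring

theorem isLinearMap_omega_right {u : ℝ} (hu : 0 < u) (X Y : Tan n x) :
    IsLinearMap ℝ fun Z => S.omega u x X Y Z where
  map_add Z Z' := by simp only [S.omega_eq hu, map_add]
  map_smul a Z := by simp only [S.omega_eq hu, map_smul]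

theorem isLinearMap_omega_middle {u : ℝ} (hu : 0 < u) (X Z : Tan n x) :
    IsLinearMap ℝ fun Y => S.omega u x X Y Z where
  map_add Y Y' := by
    have hF : (fun y => (S.P y (transport x y (Y + Y')) : Tan n y)) =
        (fun y => (S.P y (transport x y Y) : Tan n y))
          + fun y => (S.P y (transport x y Y') : Tan n y) := by
      funext y
      simp
    have hT : (fun y => (S.Q y (transport x y (Y + Y')) : Tan n y)) =
        (fun y => (S.Q y (transport x y Y) : Tan n y))
          + fun y => (S.Q y (transport x y Y') : Tan n y) := by
      funext y
      simp
    simp only [S.omega_eq hu]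
    rw [hF, hT, (S.isLeviCivita_lc hu).isCovariantDerivative.add (S.diffVFAt_P_transport Y)
      (S.diffVFAt_P_transport Y'), (S.isLeviCivita_lc hu).isCovariantDerivative.add
      (S.diffVFAt_Q_transport Y) (S.diffVFAt_Q_transport Y')]
    simp only [add_apply, map_add, Submodule.coe_add, LinearMap.add_apply]
    ring
  map_smul a Y := by
    have hF : (fun y => (S.P y (transport x y (a • Y)) : Tan n y)) =
        a • (fun y => (S.P y (transport x y Y) : Tan n y)) := by
      funext y
      simp
    have hT : (fun y => (S.Q y (transport x y (a • Y)) : Tan n y)) =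
        a • (fun y => (S.Q y (transport x y Y) : Tan n y)) := by
      funext y
      simp
    simp only [S.omega_eq hu]
    rw [hF, hT, (S.isLeviCivita_lc hu).isCovariantDerivative.smul_const a
      (S.diffVFAt_P_transport Y), (S.isLeviCivita_lc hu).isCovariantDerivative.smul_const a
      (S.diffVFAt_Q_transport Y)]
    simp only [smul_apply, map_smul, Submodule.coe_smul, LinearMap.add_apply, map_add,
      LinearMap.smul_apply, smul_eq_mul]
    ring

theorem form_F_T (u : ℝ) (y : M) (a : S.F y) (b : S.T y) :
    S.form u y (a : Tan n y) (b : Tan n y) = 0 := by simp [form_eq]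

theorem form_T_F (u : ℝ) (y : M) (a : S.F y) (b : S.T y) :
    S.form u y (b : Tan n y) (a : Tan n y) = 0 := by simp [form_eq]

/-- ℱ and 𝒯 are orthogonal, so g_{M,u}(Y, Z) vanishes identically, and so does its derivative. -/
theorem form_lc_add {u : ℝ} (hu : 0 < u) {Y : Π y, S.F y} {Z : Π y, S.T y}
    (hY : DiffVFAt (fun y => (Y y : Tan n y)) x) (hZ : DiffVFAt (fun y => (Z y : Tan n y)) x)
    (X : Tan n x) :
    S.form u x (S.lc u (fun y => (Y y : Tan n y)) x X) (Z x)
      + S.form u x (S.lc u (fun y => (Z y : Tan n y)) x X) (Y x) = 0 := by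
  have h := (S.isLeviCivita_lc hu).metric _ _ x X hY hZ
  simp only [form_F_T] at h
  rw [(S.isDiffMetric_form hu).symm x (Y x)] at h
  rw [← h]
  exact congrArg (fun L => L X) (mvfderiv_const (I := 𝓡 n) (0 : ℝ) (x := x))

theorem form_P (u : ℝ) (v : Tan n x) (a : S.F x) :
    S.form u x (S.P x v : Tan n x) (a : Tan n x) = S.form u x v (a : Tan n x) := by
  simp [form_eq]

theorem form_Q (u : ℝ) (v : Tan n x) (b : S.T x) :
    S.form u x (S.Q x v : Tan n x) (b : Tan n x) = S.form u x v (b : Tan n x) := by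
  simp [form_eq]

theorem omega_F_F {u : ℝ} (hu : 0 < u) (X : Tan n x) (a b : S.F x) :
    S.omega u x X (a : Tan n x) (b : Tan n x) = 0 := by
  rw [S.omega_eq hu, map_add, LinearMap.add_apply, form_T_F, form_P, zero_add]
  -- The 𝒯-part of the transported `a` vanishes at `x` but not necessarily nearby, so its derivative
  -- need not be zero. Metric compatibility moves the derivative onto the other field, leaving a
  -- pairing with the value at `x`, which is 0.
  have h := S.form_lc_add hu (Y := fun y => S.transportF x y b)
    (Z := fun y => S.Q y (transport x y a)) (S.diffVFAt_extF b)
    (S.diffVFAt_Q_transport (a : Tan n x)) X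
  simp only [transport_self, Q_coe_F, Submodule.coe_zero, map_zero, zero_add,
    transportF_self] at h
  exact h

theorem omega_T_T {u : ℝ} (hu : 0 < u) (X : Tan n x) (a b : S.T x) :
    S.omega u x X (a : Tan n x) (b : Tan n x) = 0 := by
  rw [S.omega_eq hu, map_add, LinearMap.add_apply, form_F_T, form_Q, add_zero]
  have h := S.form_lc_add hu (Y := fun y => S.P y (transport x y a))
    (Z := fun y => S.transportT x y b) (S.diffVFAt_P_transport (a : Tan n x))
    (S.diffVFAt_extT b) X
  simp only [transport_self, P_coe_T, Submodule.coe_zero, map_zero, add_zero,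
    transportT_self] at h
  exact h

theorem omega_F_T {u : ℝ} (hu : 0 < u) (X : Tan n x) (a : S.F x) (b : S.T x) :
    S.omega u x X (a : Tan n x) (b : Tan n x) = S.form u x (S.lc u (S.extF a) x X) b := by
  rw [S.omega_eq hu, map_add, LinearMap.add_apply, form_F_T, form_Q, add_zero]
  rfl

theorem omega_T_F {u : ℝ} (hu : 0 < u) (X : Tan n x) (a : S.F x) (b : S.T x) :
    S.omega u x X (b : Tan n x) (a : Tan n x) = -S.omega u x X (a : Tan n x) (b : Tan n x) := by
  rw [S.omega_F_T hu, S.omega_eq hu, map_add, LinearMap.add_apply, form_T_F, form_P, zero_add,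
    eq_neg_iff_add_eq_zero, add_comm]
  have h := S.form_lc_add hu (Y := fun y => S.transportF x y a)
    (Z := fun y => S.transportT x y b) (S.diffVFAt_extF a) (S.diffVFAt_extT b) X
  simp only [transportF_self, transportT_self] at h
  exact h

/-- In Koszul's formula for (c, a, b) the bracket of the two ℱ-fields is measured by u⁻¹g_𝒯 and
gives Ω_ℱ. The remaining terms form the Lie derivative of g_ℱ along `b`. -/
theorem omega_F_F_T {u : ℝ} (hu : 0 < u) (c a : S.F x) (b : S.T x) :
    S.omega u x (c : Tan n x) (a : Tan n x) (b : Tan n x) =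
      1 / 2 * (-S.lieF x b c a + u⁻¹ * S.OmegaF x (b : Tan n x) a c) := by
  rw [S.omega_F_T hu]
  have h := S.koszul_lc hu (S.diffVFAt_extF c) (S.diffVFAt_extF a) (S.diffVFAt_extT b)
  simp only [koszul, form_eq, P_extF, P_extT, Q_extF, Q_extT, map_zero, LinearMap.zero_apply,
    mul_zero, add_zero, extF_self, extT_self] at h
  rw [show mvfderiv (𝓡 n) (fun _ : M => (0 : ℝ)) x = 0 from mvfderiv_const _,
    VectorField.mlieBracket_swap_apply (V := S.extF c) (W := S.extT b),
    VectorField.mlieBracket_swap_apply (V := S.extF a) (W := S.extT b)] at h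
  simp only [form_eq, P_coe_T, Q_coe, map_zero, zero_add, lieF, OmegaF]
  rw [S.metricT.symm x b, S.metricF.symm x c]
  simp only [map_neg, LinearMap.neg_apply, zero_apply, P_coe, P_coe_T, Q_coe, Q_coe_F, map_zero,
    mul_zero] at h
  linarith

/-- The roles are exchanged: the bracket of the two 𝒯-fields is measured by g_ℱ without weight, and
the Lie derivative of g_𝒯 carries u⁻¹. -/
theorem omega_T_F_T {u : ℝ} (hu : 0 < u) (d b : S.T x) (a : S.F x) :
    S.omega u x (d : Tan n x) (a : Tan n x) (b : Tan n x) =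
      1 / 2 * (u⁻¹ * S.lieT x a d b - S.OmegaT x (a : Tan n x) b d) := by
  rw [S.omega_F_T hu]
  have h := S.koszul_lc hu (S.diffVFAt_extT d) (S.diffVFAt_extF a) (S.diffVFAt_extT b)
  simp only [koszul, form_eq, P_extF, P_extT, Q_extF, Q_extT, map_zero, LinearMap.zero_apply,
    mul_zero, zero_add, add_zero, extF_self, extT_self] at h
  have hd := S.mdifferentiableAt_gT (S.diffVFAt_extT d) (S.diffVFAt_extT b)
  simp only [Q_extT] at hd
  rw [show mvfderiv (𝓡 n) (fun _ : M => (0 : ℝ)) x = 0 from mvfderiv_const _,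
    VectorField.mlieBracket_swap_apply (V := S.extT d) (W := S.extF a),
    mvfderiv_const_mul hd] at h
  simp only [form_eq, P_coe_T, Q_coe, map_zero, zero_add, lieT, OmegaT, P_coe]
  rw [S.metricT.symm x d, S.metricF.symm x a]
  simp only [map_neg, LinearMap.neg_apply, zero_apply, P_coe, P_coe_T, Q_coe, Q_coe_F, map_zero,
    mul_zero] at h
  linarith

end Splitting

end

/-! ### Contractions over a basis and sums in an algebra with Clifford relations. -/

section

/-- The contraction of a bilinear map with the canonical element of V ⊗ V^* does not depend on the
basis. It moves the Dirac operator and two-forms from `finBasis` to adapted bases. -/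
theorem Basis.sum_apply_coord {V W ι κ : Type*} [AddCommGroup V] [Module ℝ V] [AddCommGroup W]
    [Module ℝ W] [Fintype ι] [Fintype κ] (b : Basis ι ℝ V) (b' : Basis κ ℝ V)
    {B : V → Dual ℝ V → W} (h1 : ∀ ξ, IsLinearMap ℝ fun v => B v ξ)
    (h2 : ∀ v, IsLinearMap ℝ (B v)) :
    ∑ i, B (b i) (b.coord i) = ∑ j, B (b' j) (b'.coord j) := by
  have e1 (i : ι) : B (b i) (b.coord i) = ∑ j, b'.coord j (b i) • B (b' j) (b.coord i) :=
    calc B (b i) (b.coord i) = (h1 (b.coord i)).mk' _ (∑ j, b'.repr (b i) j • b' j) := by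
          rw [b'.sum_repr]; rfl
      _ = _ := by simp only [map_sum, map_smul]; rfl
  have e2 (j : κ) : B (b' j) (b'.coord j) = ∑ i, b'.coord j (b i) • B (b' j) (b.coord i) :=
    calc B (b' j) (b'.coord j) = (h2 (b' j)).mk' _ (∑ i, b'.coord j (b i) • b.coord i) := by
          rw [b.sum_dual_apply_smul_coord]; rfl
      _ = _ := by simp only [map_sum, map_smul]; rfl
  simp only [e1, e2]
  exact Finset.sum_comm

section CliffordSums

variable {A I J : Type*} [Ring A] [Algebra ℝ A] [Fintype I] [Fintype J] [DecidableEq I]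

/-- Twice the sum is a sum of anticommutators, which vanish off the diagonal. -/
theorem sum_symm_smul_mul {c : I → A} {a : ℝ}
    (hc : ∀ i j, c i * c j + c j * c i = if i = j then algebraMap ℝ A (2 * a) else 0)
    {L : I → I → ℝ} (hL : ∀ i j, L i j = L j i) :
    ∑ i, ∑ j, L i j • (c i * c j) = algebraMap ℝ A (a * ∑ i, L i i) := by
  have h1 : ∑ i, ∑ j, L i j • (c i * c j) = ∑ i, ∑ j, L i j • (c j * c i) := by
    rw [Finset.sum_comm]
    exact Finset.sum_congr rfl fun i _ => Finset.sum_congr rfl fun j _ => by rw [hL]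
  have h2 : (2 : ℝ) • ∑ i, ∑ j, L i j • (c i * c j) =
      (2 : ℝ) • algebraMap ℝ A (a * ∑ i, L i i) := by
    rw [two_smul]
    nth_rewrite 2 [h1]
    simp only [← Finset.sum_add_distrib, ← smul_add, hc, smul_ite, smul_zero, Finset.sum_ite_eq,
      Finset.mem_univ, if_true]
    simp only [Algebra.smul_def, ← map_mul, ← map_sum, Finset.mul_sum]
    congr 1
    exact Finset.sum_congr rfl fun i _ => by ring
  exact smul_right_injective A (two_ne_zero : (2 : ℝ) ≠ 0) h2

variable {c : I → A} {m : J → A} {u : ℝ} {LF WF : J → I → I → ℝ} {LT WT : I → J → J → ℝ}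

/-- The Lie-derivative coefficients are symmetric and collapse to a trace by c² = -1. The skew ones
survive, with a sign from exchanging the indices. -/
theorem sum_horizontal
    (hc : ∀ i j, c i * c j + c j * c i = if i = j then algebraMap ℝ A (2 * (-1)) else 0)
    (hLF : ∀ μ i j, LF μ i j = LF μ j i) (hWF : ∀ μ i j, WF μ i j = -WF μ j i) :
    ∑ j, c j * ((1 / 2 : ℝ) • ∑ i, ∑ μ, (1 / 2 * (-LF μ j i + u⁻¹ * WF μ i j)) • (c i * m μ)) =
      ∑ μ, (((1 / 4 * ∑ i, LF μ i i) • (1 : A)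
        - (u⁻¹ / 2) • ((1 / 2 : ℝ) • ∑ i, ∑ j, WF μ i j • (c i * c j))) * m μ) := by
  have h1 : ∑ j, c j * ((1 / 2 : ℝ) • ∑ i, ∑ μ,
      (1 / 2 * (-LF μ j i + u⁻¹ * WF μ i j)) • (c i * m μ)) =
      ∑ μ, (∑ j, ∑ i, (1 / 4 * (-LF μ j i + u⁻¹ * WF μ i j)) • (c j * c i)) * m μ := by
    simp only [Finset.mul_sum, Finset.sum_mul, Finset.smul_sum, mul_smul_comm, smul_mul_assoc,
      smul_smul, mul_assoc]
    rw [Finset.sum_comm' (t' := Finset.univ) (s' := fun _ => Finset.univ) (by simp)]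
    conv_rhs => rw [Finset.sum_comm]
    conv_lhs => rw [Finset.sum_comm]
    refine Finset.sum_congr rfl fun j _ => ?_
    rw [Finset.sum_comm]
    refine Finset.sum_congr rfl fun i _ => Finset.sum_congr rfl fun μ _ => ?_
    congr 1
    ring
  rw [h1]
  refine Finset.sum_congr rfl fun μ _ => ?_
  congr 1
  have h2 := sum_symm_smul_mul hc (hLF μ)
  have h3 : ∑ j, ∑ i, (1 / 4 * (-LF μ j i + u⁻¹ * WF μ i j)) • (c j * c i) =
      (-(1 / 4) : ℝ) • ∑ j, ∑ i, LF μ j i • (c j * c i)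
        - (u⁻¹ / 4) • ∑ j, ∑ i, WF μ j i • (c j * c i) := by
    simp only [Finset.smul_sum, ← Finset.sum_sub_distrib, smul_smul, ← sub_smul]
    refine Finset.sum_congr rfl fun j _ => Finset.sum_congr rfl fun i _ => ?_
    rw [hWF μ i j]
    congr 1
    ring
  rw [h3, h2, Algebra.algebraMap_eq_smul_one, smul_smul, smul_smul]
  congr 2 <;> ring

/-- Each product of two generators `c` is even, so the two sign changes cancel. -/
theorem commute_sum_smul_mul (hcm : ∀ i μ, c i * m μ = -(m μ * c i)) (μ : J) (W : I → I → ℝ)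
    (a : ℝ) : m μ * (a • ∑ i, ∑ j, W i j • (c i * c j)) =
      (a • ∑ i, ∑ j, W i j • (c i * c j)) * m μ := by
  simp only [Finset.mul_sum, Finset.sum_mul, Finset.smul_sum, mul_smul_comm, smul_mul_assoc]
  refine Finset.sum_congr rfl fun i _ => Finset.sum_congr rfl fun j _ => ?_
  rw [mul_assoc (c i), hcm, mul_neg, ← mul_assoc (c i), hcm, neg_mul, neg_neg, mul_assoc]

/-- The square of `m μ` is -u, which exactly cancels the u⁻¹ in front of the symmetric coefficients:
their trace is finite and has no further dependence on `u`. -/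
theorem sum_transverse [DecidableEq J] (hu : u ≠ 0) (hcm : ∀ i μ, c i * m μ = -(m μ * c i))
    (hm : ∀ μ ν, m μ * m ν + m ν * m μ = if μ = ν then algebraMap ℝ A (2 * (-u)) else 0)
    (hLT : ∀ i μ ν, LT i μ ν = LT i ν μ) (hWT : ∀ i μ ν, WT i μ ν = -WT i ν μ) :
    ∑ ν, m ν * ((1 / 2 : ℝ) • ∑ i, ∑ μ, (1 / 2 * (u⁻¹ * LT i ν μ - WT i μ ν)) • (c i * m μ)) =
      (1 / 4 : ℝ) • ∑ i, ∑ μ, LT i μ μ • c i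
        - (1 / 4 : ℝ) • ∑ i, ∑ μ, ∑ ν, WT i μ ν • (c i * m μ * m ν) := by
  have h1 : ∑ ν, m ν * ((1 / 2 : ℝ) • ∑ i, ∑ μ,
      (1 / 2 * (u⁻¹ * LT i ν μ - WT i μ ν)) • (c i * m μ)) =
      ∑ i, c i * ∑ ν, ∑ μ, (-(1 / 4) * (u⁻¹ * LT i ν μ + WT i ν μ)) • (m ν * m μ) := by
    simp only [Finset.mul_sum, Finset.smul_sum, mul_smul_comm, smul_smul]
    rw [Finset.sum_comm]
    refine Finset.sum_congr rfl fun i _ => Finset.sum_congr rfl fun ν _ =>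
      Finset.sum_congr rfl fun μ _ => ?_
    have h : c i * (m ν * m μ) = -(m ν * (c i * m μ)) := by
      rw [← mul_assoc, hcm, neg_mul, mul_assoc]
    rw [h, smul_neg, ← neg_smul, hWT i μ ν]
    congr 1
    ring
  rw [h1, Finset.smul_sum, Finset.smul_sum, ← Finset.sum_sub_distrib]
  refine Finset.sum_congr rfl fun i _ => ?_
  have h2 := sum_symm_smul_mul hm (hLT i)
  have h3 : ∑ ν, ∑ μ, (-(1 / 4) * (u⁻¹ * LT i ν μ + WT i ν μ)) • (m ν * m μ) =
      (-(1 / 4) * u⁻¹ : ℝ) • ∑ ν, ∑ μ, LT i ν μ • (m ν * m μ)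
        - (1 / 4 : ℝ) • ∑ ν, ∑ μ, WT i ν μ • (m ν * m μ) := by
    simp only [Finset.smul_sum, ← Finset.sum_sub_distrib, smul_smul, ← sub_smul]
    refine Finset.sum_congr rfl fun j _ => Finset.sum_congr rfl fun i _ => ?_
    congr 1
    ring
  rw [h3, h2, Algebra.algebraMap_eq_smul_one, smul_smul, mul_sub]
  congr 1
  · rw [mul_smul_comm, mul_one, ← Finset.sum_smul, smul_smul]
    congr 1
    field_simp
  · simp only [Finset.mul_sum, mul_smul_comm, mul_assoc]

/-- The zeroth order part of the Dirac operator as a Laurent polynomial in `u`. -/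
theorem clifford_expansion [DecidableEq J] {ε ι : J → A} (hu : u ≠ 0)
    (hc : ∀ i j, c i * c j + c j * c i = (-(2 * if i = j then 1 else 0) : ℝ) • (1 : A))
    (hcε : ∀ i μ, c i * ε μ = -(ε μ * c i)) (hcι : ∀ i μ, c i * ι μ = -(ι μ * c i))
    (hε : ∀ μ ν, ε μ * ε ν + ε ν * ε μ = 0) (hι : ∀ μ ν, ι μ * ι ν + ι ν * ι μ = 0)
    (hει : ∀ μ ν, ε μ * ι ν + ι ν * ε μ = (if μ = ν then 1 else 0 : ℝ) • (1 : A))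
    (hLF : ∀ μ i j, LF μ i j = LF μ j i) (hWF : ∀ μ i j, WF μ i j = -WF μ j i)
    (hLT : ∀ i μ ν, LT i μ ν = LT i ν μ) (hWT : ∀ i μ ν, WT i μ ν = -WT i ν μ)
    {O : J → A} (hO : ∀ μ, O μ = (1 / 2 : ℝ) • ∑ i, ∑ j, WF μ i j • (c i * c j)) :
    ∑ j, c j * ((1 / 2 : ℝ) • ∑ i, ∑ μ,
        (1 / 2 * (-LF μ j i + u⁻¹ * WF μ i j)) • (c i * (ε μ - u • ι μ)))
      + ∑ ν, (ε ν - u • ι ν) * ((u⁻¹ / 4) • O ν + (1 / 2 : ℝ) • ∑ i, ∑ μ,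
        (1 / 2 * (u⁻¹ * LT i ν μ - WT i μ ν)) • (c i * (ε μ - u • ι μ))) =
    u⁻¹ • (-(1 / 4 : ℝ) • ∑ μ, O μ * ε μ)
      + ((1 / 4 : ℝ) • ((1 / 2 : ℝ) • ∑ i, ∑ j, ∑ μ, WF μ i j • (c i * (c j * ι μ)))
        + (1 / 4 : ℝ) • ∑ i, ∑ μ, LF μ i i • ε μ
        - (1 / 2 : ℝ) • ((1 / 2 : ℝ) • ∑ i, ∑ μ, ∑ ν, WT i μ ν • (c i * (ε μ * ε ν)))
        + (1 / 4 : ℝ) • ∑ i, ∑ μ, LT i μ μ • c i)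
      + u • (-(1 / 4 : ℝ) • ∑ i, ∑ μ, LF μ i i • ι μ
        + (1 / 4 : ℝ) • ∑ i, ∑ μ, ∑ ν, WT i μ ν • (c i * (ε μ * ι ν + ι μ * ε ν)))
      + u ^ 2 • (-(1 / 4 : ℝ) • ∑ i, ∑ μ, ∑ ν, WT i μ ν • (c i * (ι μ * ι ν))) := by
  have hc' : ∀ i j, c i * c j + c j * c i =
      if i = j then algebraMap ℝ A (2 * (-1)) else 0 := fun i j => by
    rw [hc, Algebra.algebraMap_eq_smul_one]
    split_ifs <;> simp
  have hcm : ∀ i μ, c i * (ε μ - u • ι μ) = -((ε μ - u • ι μ) * c i) := fun i μ => by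
    rw [mul_sub, sub_mul, hcε, mul_smul_comm, hcι, smul_mul_assoc, smul_neg]
    abel
  have hm : ∀ μ ν, (ε μ - u • ι μ) * (ε ν - u • ι ν) + (ε ν - u • ι ν) * (ε μ - u • ι μ) =
      if μ = ν then algebraMap ℝ A (2 * (-u)) else 0 := fun μ ν => by
    have h : (ε μ - u • ι μ) * (ε ν - u • ι ν) + (ε ν - u • ι ν) * (ε μ - u • ι μ) =
        (ε μ * ε ν + ε ν * ε μ) - u • (ε μ * ι ν + ι ν * ε μ) - u • (ε ν * ι μ + ι μ * ε ν)
          + u ^ 2 • (ι μ * ι ν + ι ν * ι μ) := by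
      simp only [mul_sub, sub_mul, mul_smul_comm, smul_mul_assoc]
      module
    rw [h, hε, hι, hει, hει]
    by_cases hμν : μ = ν
    · simp only [hμν, if_true, Algebra.algebraMap_eq_smul_one]
      module
    · simp [hμν, Ne.symm hμν]
  simp_rw [mul_add (ε _ - u • ι _)]
  rw [Finset.sum_add_distrib, sum_horizontal (m := fun μ => ε μ - u • ι μ) hc' hLF hWF, sum_transverse (m := fun μ => ε μ - u • ι μ) hu hcm hm hLT hWT]
  -- Since `O μ` commutes with ε - uι, the coefficients -u⁻¹/2 and u⁻¹/4 add up to -u⁻¹/4. The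
  -- factor -u in front of ι turns part of this into the finite term ¼ O ι.
  have h1 : ∑ μ, (((1 / 4 * ∑ i, LF μ i i) • (1 : A)
        - (u⁻¹ / 2) • ((1 / 2 : ℝ) • ∑ i, ∑ j, WF μ i j • (c i * c j))) * (ε μ - u • ι μ))
      + ∑ ν, (ε ν - u • ι ν) * ((u⁻¹ / 4) • O ν) =
      u⁻¹ • (-(1 / 4 : ℝ) • ∑ μ, O μ * ε μ) + (1 / 4 : ℝ) • ∑ μ, O μ * ι μ
      + (1 / 4 : ℝ) • ∑ i, ∑ μ, LF μ i i • ε μ + u • (-(1 / 4 : ℝ) • ∑ i, ∑ μ, LF μ i i • ι μ) := by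
    have hs (y : J → A) : ∑ i, ∑ μ, LF μ i i • y μ = ∑ μ, (∑ i, LF μ i i) • y μ := by
      rw [Finset.sum_comm]
      simp only [Finset.sum_smul]
    rw [hs, hs]
    simp only [← hO, Finset.smul_sum (N := A), ← Finset.sum_add_distrib]
    refine Finset.sum_congr rfl fun μ _ => ?_
    have hcomm : (ε μ - u • ι μ) * O μ = O μ * (ε μ - u • ι μ) := by
      rw [hO]
      exact commute_sum_smul_mul (m := fun μ => ε μ - u • ι μ) hcm μ _ _
    rw [mul_smul_comm, hcomm]
    generalize ∑ i, LF μ i i = t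
    simp only [sub_mul, mul_sub, smul_mul_assoc, one_mul, mul_smul_comm, smul_sub, smul_smul]
    match_scalars <;> field_simp <;> ring
  have h2 : ∑ μ, O μ * ι μ = (1 / 2 : ℝ) • ∑ i, ∑ j, ∑ μ, WF μ i j • (c i * (c j * ι μ)) := by
    simp only [hO, Finset.smul_sum, Finset.sum_mul, smul_mul_assoc, mul_assoc]
    rw [Finset.sum_comm]
    exact Finset.sum_congr rfl fun i _ => Finset.sum_comm
  have h3 : ∑ i, ∑ μ, ∑ ν, WT i μ ν • (c i * (ε μ - u • ι μ) * (ε ν - u • ι ν)) =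
      ∑ i, ∑ μ, ∑ ν, WT i μ ν • (c i * (ε μ * ε ν))
        - u • ∑ i, ∑ μ, ∑ ν, WT i μ ν • (c i * (ε μ * ι ν + ι μ * ε ν))
        + u ^ 2 • ∑ i, ∑ μ, ∑ ν, WT i μ ν • (c i * (ι μ * ι ν)) := by
    simp only [Finset.smul_sum, ← Finset.sum_add_distrib, ← Finset.sum_sub_distrib]
    refine Finset.sum_congr rfl fun i _ => Finset.sum_congr rfl fun μ _ =>
      Finset.sum_congr rfl fun ν _ => ?_
    simp only [mul_sub, sub_mul, mul_add, mul_smul_comm, smul_mul_assoc, smul_smul, mul_assoc]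
    match_scalars <;> ring
  rw [← h2, h3]
  linear_combination (norm := module) h1

end CliffordSums

end

/-! ### Adapted bases and the Clifford relations on E ⊗ ∧𝒯^*. -/

section

variable {n n₁ n₂ : ℕ} {M : Type*} [TopologicalSpace M]
  [ChartedSpace (EuclideanSpace ℝ (Fin n)) M] [IsManifold (𝓡 n) ∞ M]

theorem contractLeft_contractLeft_add {V : Type*} [AddCommGroup V] [Module ℝ V] (d d' : Dual ℝ V)
    (a : ExteriorAlgebra ℝ V) :
    CliffordAlgebra.contractLeft d (CliffordAlgebra.contractLeft d' a)
      + CliffordAlgebra.contractLeft d' (CliffordAlgebra.contractLeft d a) = 0 := by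
  rw [CliffordAlgebra.contractLeft_comm, neg_add_cancel]

theorem ι_mul_contractLeft_add {V : Type*} [AddCommGroup V] [Module ℝ V] (d : Dual ℝ V) (v : V)
    (a : ExteriorAlgebra ℝ V) :
    ExteriorAlgebra.ι ℝ v * CliffordAlgebra.contractLeft d a
      + CliffordAlgebra.contractLeft d (ExteriorAlgebra.ι ℝ v * a) = d v • a := by
  rw [ExteriorAlgebra.ι, CliffordAlgebra.contractLeft_ι_mul, add_sub_cancel]

namespace Splitting

variable (S : Splitting n n₁ n₂ M) {x : M}

section AdaptedBasis

variable (e : Basis (Fin n₁) ℝ (S.F x)) (f : Basis (Fin n₂) ℝ (S.T x))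

/-- The basis of the tangent space formed by a basis of `F` and a basis of `T`. -/
def adaptedBasis : Basis (Fin n₁ ⊕ Fin n₂) ℝ (Tan n x) :=
  (e.prod f).map (Submodule.prodEquivOfIsCompl _ _ (S.isCompl x))

theorem adaptedBasis_inl (i : Fin n₁) : S.adaptedBasis e f (Sum.inl i) = (e i : Tan n x) := by
  simp [adaptedBasis]

theorem adaptedBasis_inr (μ : Fin n₂) : S.adaptedBasis e f (Sum.inr μ) = (f μ : Tan n x) := by
  simp [adaptedBasis]

theorem adaptedBasis_coord_inl (i : Fin n₁) :
    (S.adaptedBasis e f).coord (Sum.inl i) = e.coord i ∘ₗ S.P x := by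
  classical
  refine (S.adaptedBasis e f).ext fun a => ?_
  rw [Basis.coord_apply, Basis.repr_self]
  cases a with
  | inl j => simp [adaptedBasis_inl, Finsupp.single_apply]
  | inr μ => simp [adaptedBasis_inr]

theorem adaptedBasis_coord_inr (μ : Fin n₂) :
    (S.adaptedBasis e f).coord (Sum.inr μ) = f.coord μ ∘ₗ S.Q x := by
  classical
  refine (S.adaptedBasis e f).ext fun a => ?_
  rw [Basis.coord_apply, Basis.repr_self]
  cases a with
  | inl j => simp [adaptedBasis_inl]
  | inr μ => simp [adaptedBasis_inr, Finsupp.single_apply]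

end AdaptedBasis

theorem gF_eq_coord {e : Basis (Fin n₁) ℝ (S.F x)}
    (he : ∀ i j, S.gF x (e i) (e j) = if i = j then 1 else 0) (i : Fin n₁) :
    S.gF x (e i) = e.coord i := by
  refine e.ext fun j => ?_
  rw [he, Basis.coord_apply, Basis.repr_self, Finsupp.single_apply]
  simp [eq_comm]

/-- For an orthonormal basis the metric dual of the coordinate covector is the basis vector, so the
contraction in `clT` is along `f μ`. -/
theorem raise_coord {f : Basis (Fin n₂) ℝ (S.T x)}
    (hf : ∀ μ ν, S.gT x (f μ) (f ν) = if μ = ν then 1 else 0) (μ : Fin n₂) :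
    raise (S.gT x) (S.metricT.nondegenerate x) (f.coord μ) = f μ := by
  refine S.gT_ext fun z => ?_
  have h : S.gT x (f μ) = f.coord μ := S.swap.gF_eq_coord (e := f) hf μ
  rw [raise_spec _ _ (f.coord μ).isLinear, h]

end Splitting

variable {FE : Type*} [NormedAddCommGroup FE] [NormedSpace ℂ FE]
  {E : M → Type*} [TopologicalSpace (TotalSpace FE E)]
  [∀ x, AddCommGroup (E x)] [∀ x, Module ℂ (E x)] [∀ x, TopologicalSpace (E x)]
  [∀ x, IsTopologicalAddGroup (E x)] [∀ x, ContinuousSMul ℝ (E x)]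
  [FiberBundle FE E] [VectorBundle ℝ FE E] {S : Splitting n n₁ n₂ M}

namespace CliffordModule

variable (C : CliffordModule FE E S) {x : M}

theorem γ_γ (s : E x) : C.γ x (C.γ x s) = s := LinearMap.congr_fun (C.γ_sq x) s

theorem γ_c (φ : Dual ℝ (S.F x)) (s : E x) : C.γ x (C.c x φ s) = -C.c x φ (C.γ x s) :=
  LinearMap.congr_fun (C.c_odd x φ) s

/-- Polarization of `c_sq`. -/
theorem c_gF_c_gF (v w : S.F x) (s : E x) :
    C.c x (S.gF x v) (C.c x (S.gF x w) s) + C.c x (S.gF x w) (C.c x (S.gF x v) s) =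
      (-(2 * S.gF x v w)) • s := by
  have h (v : S.F x) : C.c x (S.gF x v) (C.c x (S.gF x v) s) = (-(S.gF x v v)) • s :=
    LinearMap.congr_fun (C.c_sq x v) s
  have h1 := h (v + w)
  simp only [map_add, LinearMap.add_apply, h v, h w, S.metricF.symm x w v] at h1
  linear_combination (norm := module) h1

theorem cl_tmul (φ : Dual ℝ (S.F x)) (s : E x) (a : ExteriorAlgebra ℝ (Dual ℝ (S.T x))) :
    C.cl x φ (s ⊗ₜ a) = C.c x φ s ⊗ₜ a := rfl

theorem eps_tmul (ψ : Dual ℝ (S.T x)) (s : E x) (a : ExteriorAlgebra ℝ (Dual ℝ (S.T x))) :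
    C.eps x ψ (s ⊗ₜ a) = C.γ x s ⊗ₜ (ExteriorAlgebra.ι ℝ ψ * a) := rfl

theorem iot_tmul (f : S.T x) (s : E x) (a : ExteriorAlgebra ℝ (Dual ℝ (S.T x))) :
    C.iot x f (s ⊗ₜ a) =
      C.γ x s ⊗ₜ CliffordAlgebra.contractLeft (Dual.eval ℝ (S.T x) f) a := rfl

theorem cl_mul_cl (v w : S.F x) :
    (C.cl x (S.gF x v) * C.cl x (S.gF x w) + C.cl x (S.gF x w) * C.cl x (S.gF x v) :
      Module.End ℝ (Fib E S x)) = (-(2 * S.gF x v w)) • (1 : Module.End ℝ (Fib E S x)) := by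
  refine TensorProduct.ext' fun s a => ?_
  rw [LinearMap.add_apply, Module.End.mul_apply, Module.End.mul_apply]
  simp only [cl_tmul, ← TensorProduct.add_tmul, c_gF_c_gF, LinearMap.smul_apply,
    Module.End.one_apply, TensorProduct.smul_tmul']

/-- The sign of the graded tensor product sits in the factor γ of ε and ι, which anticommutes with
c. Relations among ε and ι alone use γ² = 1 and reduce to the exterior algebra. -/
theorem cl_mul_eps (φ : Dual ℝ (S.F x)) (ψ : Dual ℝ (S.T x)) :
    (C.cl x φ * C.eps x ψ : Module.End ℝ (Fib E S x)) = -(C.eps x ψ * C.cl x φ) := by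
  refine TensorProduct.ext' fun s a => ?_
  rw [LinearMap.neg_apply, Module.End.mul_apply, Module.End.mul_apply]
  simp only [cl_tmul, eps_tmul, γ_c, TensorProduct.neg_tmul, neg_neg]

theorem cl_mul_iot (φ : Dual ℝ (S.F x)) (f : S.T x) :
    (C.cl x φ * C.iot x f : Module.End ℝ (Fib E S x)) = -(C.iot x f * C.cl x φ) := by
  refine TensorProduct.ext' fun s a => ?_
  rw [LinearMap.neg_apply, Module.End.mul_apply, Module.End.mul_apply]
  simp only [cl_tmul, iot_tmul, γ_c, TensorProduct.neg_tmul, neg_neg]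

theorem eps_mul_eps (ψ ψ' : Dual ℝ (S.T x)) :
    (C.eps x ψ * C.eps x ψ' + C.eps x ψ' * C.eps x ψ : Module.End ℝ (Fib E S x)) = 0 := by
  refine TensorProduct.ext' fun s a => ?_
  rw [LinearMap.add_apply, Module.End.mul_apply, Module.End.mul_apply]
  simp only [eps_tmul, γ_γ, ← TensorProduct.tmul_add, ← mul_assoc, ← add_mul,
    ExteriorAlgebra.ι_add_mul_swap, zero_mul, TensorProduct.tmul_zero, LinearMap.zero_apply]

theorem iot_mul_iot (f f' : S.T x) :
    (C.iot x f * C.iot x f' + C.iot x f' * C.iot x f : Module.End ℝ (Fib E S x)) = 0 := by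
  refine TensorProduct.ext' fun s a => ?_
  rw [LinearMap.add_apply, Module.End.mul_apply, Module.End.mul_apply]
  simp only [iot_tmul, γ_γ, ← TensorProduct.tmul_add, contractLeft_contractLeft_add,
    TensorProduct.tmul_zero, LinearMap.zero_apply]

theorem eps_mul_iot (ψ : Dual ℝ (S.T x)) (f : S.T x) :
    (C.eps x ψ * C.iot x f + C.iot x f * C.eps x ψ : Module.End ℝ (Fib E S x)) =
      ψ f • (1 : Module.End ℝ (Fib E S x)) := by
  refine TensorProduct.ext' fun s a => ?_
  rw [LinearMap.add_apply, Module.End.mul_apply, Module.End.mul_apply]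
  simp only [iot_tmul, eps_tmul, γ_γ, ← TensorProduct.tmul_add, ι_mul_contractLeft_add,
    LinearMap.smul_apply, Module.End.one_apply, TensorProduct.tmul_smul, Dual.eval_apply]

/-! ### Linearity and change of basis -/

theorem isLinearMap_cl : IsLinearMap ℝ (C.cl x) where
  map_add φ φ' := TensorProduct.ext' fun s a => by
    simp [cl_tmul, TensorProduct.add_tmul]
  map_smul r φ := TensorProduct.ext' fun s a => by
    simp [cl_tmul, TensorProduct.smul_tmul']

theorem isLinearMap_m (u : ℝ) : IsLinearMap ℝ (C.m u x) where
  map_add ξ ξ' := by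
    refine TensorProduct.ext' fun s a => ?_
    simp [m, clT, cl_tmul, eps_tmul, iot_tmul, raise, LinearMap.add_comp, TensorProduct.add_tmul,
      TensorProduct.tmul_add, add_mul, add_smul, Finset.sum_add_distrib]
    abel
  map_smul r ξ := by
    refine TensorProduct.ext' fun s a => ?_
    simp [m, clT, cl_tmul, eps_tmul, iot_tmul, raise, LinearMap.smul_comp,
      TensorProduct.tmul_smul, mul_smul, ← Finset.smul_sum, smul_sub, smul_comm u r,
      ← TensorProduct.smul_tmul']

end CliffordModule

end

/-! ### The Clifford actions of ω_u and Ω_ℱ in adapted bases. -/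

section

theorem Basis.sum_sum_smul_mul {V A ι κ : Type*} [AddCommGroup V] [Module ℝ V] [Ring A]
    [Algebra ℝ A] [Fintype ι] [Fintype κ] (b : Basis ι ℝ V) (b' : Basis κ ℝ V) {α : V → V → ℝ}
    (h1 : ∀ w, IsLinearMap ℝ fun v => α v w) (h2 : ∀ v, IsLinearMap ℝ (α v)) {T : Dual ℝ V → A}
    (hT : IsLinearMap ℝ T) :
    ∑ i, ∑ j, α (b i) (b j) • (T (b.coord i) * T (b.coord j)) =
      ∑ i, ∑ j, α (b' i) (b' j) • (T (b'.coord i) * T (b'.coord j)) := by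
  have e1 (i : ι) : ∑ j, α (b i) (b j) • (T (b.coord i) * T (b.coord j)) =
      ∑ j, α (b i) (b' j) • (T (b.coord i) * T (b'.coord j)) :=
    Basis.sum_apply_coord b b' (B := fun w η => α (b i) w • (T (b.coord i) * T η))
      (fun η => ⟨fun v w => by simp only [(h2 _).map_add, add_smul],
        fun r v => by simp only [(h2 _).map_smul, smul_assoc]⟩)
      (fun w => ⟨fun v w => by simp only [hT.map_add, mul_add, smul_add],
        fun r v => by simp only [hT.map_smul, mul_smul_comm, smul_comm r]⟩)
  simp only [e1]
  exact Basis.sum_apply_coord b b'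
    (B := fun v ξ => ∑ j, α v (b' j) • (T ξ * T (b'.coord j)))
    (fun η => ⟨fun v w => by simp only [(h1 _).map_add, add_smul, Finset.sum_add_distrib],
      fun r v => by simp only [(h1 _).map_smul, smul_assoc, Finset.smul_sum]⟩)
    (fun w => ⟨fun v w => by simp only [hT.map_add, add_mul, smul_add, Finset.sum_add_distrib],
      fun r v => by simp only [hT.map_smul, smul_mul_assoc, smul_comm r, Finset.smul_sum]⟩)

/-- Only the two mixed blocks contribute, and they agree: skewness of the coefficients and
anticommutation of the generators each give a sign. The factor ½ thus disappears. -/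
theorem half_sum_skew_smul_mul {A I J : Type*} [Ring A] [Algebra ℝ A] [Fintype I] [Fintype J]
    {T : I ⊕ J → A} (hT : ∀ i j, T (.inl i) * T (.inr j) = -(T (.inr j) * T (.inl i)))
    {α : I ⊕ J → I ⊕ J → ℝ} (h1 : ∀ i i', α (.inl i) (.inl i') = 0)
    (h2 : ∀ j j', α (.inr j) (.inr j') = 0) (h3 : ∀ i j, α (.inr j) (.inl i) = -α (.inl i) (.inr j)) :
    (1 / 2 : ℝ) • ∑ a, ∑ b, α a b • (T a * T b) =
      ∑ i, ∑ j, α (.inl i) (.inr j) • (T (.inl i) * T (.inr j)) := by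
  have h (i : I) (j : J) : α (.inr j) (.inl i) • (T (.inr j) * T (.inl i)) =
      α (.inl i) (.inr j) • (T (.inl i) * T (.inr j)) := by
    rw [h3, hT, smul_neg, neg_smul]
  simp only [Fintype.sum_sum_type, h1, h2, h, zero_smul, Finset.sum_const_zero, zero_add, add_zero]
  rw [Finset.sum_comm (s := Finset.univ (α := J)), ← two_smul ℝ, smul_smul]
  norm_num

theorem mul_sub_smul_of_anticommute {A : Type*} [Ring A] [Algebra ℝ A] {c ε ι : A}
    (hε : c * ε = -(ε * c)) (hι : c * ι = -(ι * c)) (u : ℝ) :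
    c * (ε - u • ι) = -((ε - u • ι) * c) := by
  rw [mul_sub, sub_mul, hε, mul_smul_comm, hι, smul_mul_assoc, smul_neg]
  abel

variable {n n₁ n₂ : ℕ} {M : Type*} [TopologicalSpace M]
  [ChartedSpace (EuclideanSpace ℝ (Fin n)) M] [IsManifold (𝓡 n) ∞ M]
  {FE : Type*} [NormedAddCommGroup FE] [NormedSpace ℂ FE]
  {E : M → Type*} [TopologicalSpace (TotalSpace FE E)]
  [∀ x, AddCommGroup (E x)] [∀ x, Module ℂ (E x)] [∀ x, TopologicalSpace (E x)]
  [∀ x, IsTopologicalAddGroup (E x)] [∀ x, ContinuousSMul ℝ (E x)]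
  [FiberBundle FE E] [VectorBundle ℝ FE E] {S : Splitting n n₁ n₂ M}

namespace Splitting

theorem isLinearMap_OmegaF_middle (U : Tan n x) (Z : S.F x) :
    IsLinearMap ℝ fun Y => S.OmegaF x U Y Z where
  map_add Y Y' := by
    rw [OmegaF_swap, (S.isLinearMap_OmegaF U Z).map_add, S.OmegaF_swap U Y, S.OmegaF_swap U Y']
    ring
  map_smul a Y := by
    rw [OmegaF_swap, (S.isLinearMap_OmegaF U Z).map_smul, S.OmegaF_swap U Y, smul_neg]

end Splitting

namespace CliffordModule

variable (C : CliffordModule FE E S) {x : M}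

theorem m_comp_P (u : ℝ) (φ : Dual ℝ (S.F x)) : C.m u x (φ ∘ₗ S.P x) = C.cl x φ := by
  have h1 : (φ ∘ₗ S.P x) ∘ₗ (S.F x).subtype = φ := by
    ext v
    simp
  have h2 : (φ ∘ₗ S.P x) ∘ₗ (S.T x).subtype = 0 := by
    ext v
    simp
  have h3 : raise (S.gT x) (S.metricT.nondegenerate x) (0 : Dual ℝ (S.T x)) = 0 := by
    simp [raise]
  rw [m, h1, h2, clT, h3]
  refine TensorProduct.ext' fun s a => ?_
  simp only [LinearMap.add_apply, LinearMap.sub_apply, LinearMap.smul_apply, eps_tmul, iot_tmul,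
    map_zero, zero_mul, LinearMap.zero_apply, TensorProduct.tmul_zero, smul_zero, sub_zero,
    add_zero]

theorem m_comp_Q (u : ℝ) (ψ : Dual ℝ (S.T x)) : C.m u x (ψ ∘ₗ S.Q x) = C.clT u x ψ := by
  have h1 : (ψ ∘ₗ S.Q x) ∘ₗ (S.T x).subtype = ψ := by
    ext v
    simp
  have h2 : (ψ ∘ₗ S.Q x) ∘ₗ (S.F x).subtype = 0 := by
    ext v
    simp
  rw [m, h1, h2, C.isLinearMap_cl.map_zero, zero_add]

variable {e : Basis (Fin n₁) ℝ (S.F x)} {f : Basis (Fin n₂) ℝ (S.T x)}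

theorem cl_coord_mul_cl_coord (he : ∀ i j, S.gF x (e i) (e j) = if i = j then 1 else 0)
    (i j : Fin n₁) : (C.cl x (e.coord i) * C.cl x (e.coord j)
      + C.cl x (e.coord j) * C.cl x (e.coord i) : Module.End ℝ (Fib E S x)) =
      (-(2 * if i = j then 1 else 0) : ℝ) • (1 : Module.End ℝ (Fib E S x)) := by
  have h := C.cl_mul_cl (e i) (e j)
  rw [S.gF_eq_coord he i, S.gF_eq_coord he j] at h
  refine h.trans (congrArg (· • _) ?_)
  rw [← S.gF_eq_coord he, he]

theorem m_coord_inl (u : ℝ) (i : Fin n₁) :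
    C.m u x ((S.adaptedBasis e f).coord (Sum.inl i)) = C.cl x (e.coord i) := by
  rw [Splitting.adaptedBasis_coord_inl, m_comp_P]

theorem m_coord_inr (hf : ∀ μ ν, S.gT x (f μ) (f ν) = if μ = ν then 1 else 0) (u : ℝ)
    (μ : Fin n₂) : C.m u x ((S.adaptedBasis e f).coord (Sum.inr μ)) =
      C.eps x (f.coord μ) - u • C.iot x (f μ) := by
  rw [Splitting.adaptedBasis_coord_inr, m_comp_Q, clT, S.raise_coord hf]

theorem mTwo_omega (hf : ∀ μ ν, S.gT x (f μ) (f ν) = if μ = ν then 1 else 0) {u : ℝ} (hu : 0 < u)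
    (X : Tan n x) : (C.mTwo u x (S.omega u x X) : Module.End ℝ (Fib E S x)) =
      ∑ i, ∑ μ, S.omega u x X (e i : Tan n x) (f μ : Tan n x) •
        ((C.cl x (e.coord i) : Module.End ℝ (Fib E S x)) *
          ((C.eps x (f.coord μ) : Module.End ℝ (Fib E S x)) - u • C.iot x (f μ))) := by
  have h := Basis.sum_sum_smul_mul (A := Module.End ℝ (Fib E S x)) (finBasis ℝ (Tan n x))
    (S.adaptedBasis e f) (S.isLinearMap_omega_middle hu X) (S.isLinearMap_omega_right hu X)
    (C.isLinearMap_m u)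
  have h' := half_sum_skew_smul_mul (A := Module.End ℝ (Fib E S x))
    (T := fun a => C.m u x ((S.adaptedBasis e f).coord a))
    (α := fun a b => S.omega u x X (S.adaptedBasis e f a) (S.adaptedBasis e f b))
    (fun i μ => by
      rw [m_coord_inl, m_coord_inr C hf]
      exact mul_sub_smul_of_anticommute (C.cl_mul_eps _ _) (C.cl_mul_iot _ _) u)
    (fun i j => by rw [Splitting.adaptedBasis_inl, Splitting.adaptedBasis_inl, S.omega_F_F hu])
    (fun i j => by rw [Splitting.adaptedBasis_inr, Splitting.adaptedBasis_inr, S.omega_T_T hu])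
    (fun i j => by rw [Splitting.adaptedBasis_inr, Splitting.adaptedBasis_inl, S.omega_T_F hu])
  refine (congrArg ((1 / 2 : ℝ) • ·) h).trans (h'.trans ?_)
  refine Finset.sum_congr rfl fun i _ => Finset.sum_congr rfl fun μ _ => ?_
  simp only [Splitting.adaptedBasis_inl, Splitting.adaptedBasis_inr, m_coord_inl,
    m_coord_inr C hf]

/-- `c(ι_X Ω_F) ⊗ I`. -/
def clOmegaF (x : M) (X : Tan n x) : Module.End ℝ (Fib E S x) :=
  LinearMap.rTensor _ ((C.cOmegaF x X).restrictScalars ℝ)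

theorem clOmegaF_eq {ι : Type*} [Fintype ι] (e : Basis ι ℝ (S.F x)) (X : Tan n x) : C.clOmegaF x X =
    (1 / 2 : ℝ) • ∑ i, ∑ j, S.OmegaF x X (e i) (e j) •
      ((C.cl x (e.coord i) : Module.End ℝ (Fib E S x)) * C.cl x (e.coord j)) := by
  have h := Basis.sum_sum_smul_mul (A := Module.End ℝ (Fib E S x)) (finBasis ℝ (S.F x))
    e (Splitting.isLinearMap_OmegaF_middle X) (S.isLinearMap_OmegaF X) C.isLinearMap_cl
  rw [← h]
  refine TensorProduct.ext' fun s a => ?_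
  simp only [clOmegaF, cOmegaF, LinearMap.rTensor_tmul, LinearMap.coe_restrictScalars,
    LinearMap.smul_apply, LinearMap.sum_apply, LinearMap.comp_apply, Module.End.mul_apply, cl_tmul,
    ← TensorProduct.sum_tmul, TensorProduct.smul_tmul']

theorem isLinearMap_cOmegaF : IsLinearMap ℝ (C.cOmegaF x) where
  map_add X Y := by
    simp only [cOmegaF, (S.isLinearMap_OmegaF_left _ _).map_add, add_smul, Finset.sum_add_distrib,
      smul_add]
  map_smul r X := by
    simp only [cOmegaF, (S.isLinearMap_OmegaF_left _ _).map_smul, smul_assoc, Finset.smul_sum,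
      smul_comm r]

/-- Ω_ℱ sees only the 𝒯-part of `X`. Hence the singular correction in ∇^{E,u} acts in transverse
directions only; dually, `soTDer` acts in ℱ-directions only. -/
theorem clOmegaF_coe_F (X : S.F x) : C.clOmegaF x (X : Tan n x) = 0 := by
  rw [clOmegaF_eq C (finBasis ℝ (S.F x))]
  simp only [Splitting.OmegaF_coe_F, zero_smul, Finset.sum_const_zero, smul_zero]

end CliffordModule

end

/-! ### The tensor product connection and the Dirac operator in adapted bases. -/

section

variable {n n₁ n₂ : ℕ} {M : Type*} [TopologicalSpace M]
  [ChartedSpace (EuclideanSpace ℝ (Fin n)) M] [IsManifold (𝓡 n) ∞ M]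

/-- The action of the endomorphism `𝔰𝔬Ω_T(X)` of `T` on `E ⊗ ∧T^*`, as a derivation. -/
def soTDer (E : M → Type*) [∀ x, AddCommGroup (E x)] [∀ x, Module ℂ (E x)]
    (S : Splitting n n₁ n₂ M) (x : M) (X : Tan n x) : Fib E S x →ₗ[ℝ] Fib E S x :=
  -∑ μ, ∑ ν, (finBasis ℝ (S.T x)).coord μ (S.soT x X (finBasis ℝ (S.T x) ν)) •
    LinearMap.lTensor (E x)
      (LinearMap.mulLeft ℝ (ExteriorAlgebra.ι ℝ ((finBasis ℝ (S.T x)).coord ν)) ∘ₗ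
        CliffordAlgebra.contractLeft (Dual.eval ℝ (S.T x) (finBasis ℝ (S.T x) μ)))

theorem soTDer_coe_T {E : M → Type*} [∀ x, AddCommGroup (E x)] [∀ x, Module ℂ (E x)]
    {S : Splitting n n₁ n₂ M} {x : M} (U : S.T x) : soTDer E S x (U : Tan n x) = 0 := by
  simp only [soTDer, Splitting.soT_coe_T, map_zero, zero_smul, Finset.sum_const_zero, neg_zero]

variable {FE : Type*} [NormedAddCommGroup FE] [NormedSpace ℂ FE]
  {E : M → Type*} [TopologicalSpace (TotalSpace FE E)]
  [∀ x, AddCommGroup (E x)] [∀ x, Module ℂ (E x)] [∀ x, TopologicalSpace (E x)]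
  [FiberBundle FE E] [VectorBundle ℝ FE E] {S : Splitting n n₁ n₂ M} {x : M}

theorem symmₗ_linearMapAt (s : E x) : (trivializationAt FE E x).symmₗ ℝ x
    ((trivializationAt FE E x).linearMapAt ℝ x s) = s :=
  Trivialization.symmₗ_linearMapAt _ (FiberBundle.mem_baseSet_trivializationAt' x) s

theorem rTensor_localRep_self (σ : Π x, Fib E S x) :
    LinearMap.rTensor _ ((trivializationAt FE E x).symmₗ ℝ x) (localRep FE σ x x) = σ x := by
  have h : S.transportT x x = LinearMap.id := LinearMap.ext S.transportT_self
  rw [localRep, h]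
  induction σ x using TensorProduct.induction_on with
  | zero => simp
  | tmul s a => simp [symmₗ_linearMapAt]
  | add s t hs ht => rw [map_add, map_add, hs, ht]

variable [FiniteDimensional ℂ FE]

theorem isLinearMap_tensorConn {DE : (Π y, E y) → Π x : M, Tan n x → E x}
    {DT : (Π y, S.T y) → Π x : M, Tan n x → S.T x} (hE : ∀ s, IsLinearMap ℝ (DE s x))
    (hT : ∀ U, IsLinearMap ℝ (DT U x)) (σ : Π x, Fib E S x) :
    IsLinearMap ℝ (tensorConn FE DE DT σ x) where
  map_add X Y := by
    have h : (fun a => DE (fun y => (trivializationAt FE E x).symmₗ ℝ y (finBasis ℝ FE a)) x (X + Y))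
        = (fun a => DE (fun y => (trivializationAt FE E x).symmₗ ℝ y (finBasis ℝ FE a)) x X)
          + fun a => DE (fun y => (trivializationAt FE E x).symmₗ ℝ y (finBasis ℝ FE a)) x Y :=
      funext fun a => (hE _).map_add X Y
    simp only [tensorConn, h, (hT _).map_add, map_add, add_smul, Finset.sum_add_distrib,
      LinearMap.rTensor_add, LinearMap.add_apply]
    abel
  map_smul r X := by
    have h : (fun a => DE (fun y => (trivializationAt FE E x).symmₗ ℝ y (finBasis ℝ FE a)) x (r • X))
        = r • (fun a => DE (fun y => (trivializationAt FE E x).symmₗ ℝ y (finBasis ℝ FE a)) x X) :=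
      funext fun a => (hE _).map_smul r X
    simp only [tensorConn, h, (hT _).map_smul, map_smul, smul_assoc, ← Finset.smul_sum,
      LinearMap.rTensor_smul, LinearMap.smul_apply, smul_add, smul_sub]

/-- Zeroth-order changes of the two connections act as an endomorphism and as a derivation. The
change on 𝒯 is only needed on transported vectors, the only sections to which `tensorConn` applies
`DT`. -/
theorem tensorConn_eq_add {DE DE' : (Π y, E y) → Π x : M, Tan n x → E x}
    {DT DT' : (Π y, S.T y) → Π x : M, Tan n x → S.T x} {X : Tan n x} {K : E x →ₗ[ℝ] E x}
    {R : S.T x → S.T x} (hE : ∀ s, DE' s x X = DE s x X + K (s x))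
    (hT : ∀ v, DT' (fun y => S.transportT x y v) x X = DT (fun y => S.transportT x y v) x X + R v)
    (σ : Π x, Fib E S x) :
    tensorConn FE DE' DT' σ x X = tensorConn FE DE DT σ x X + LinearMap.rTensor _ K (σ x)
      - ∑ μ, ∑ ν, (finBasis ℝ (S.T x)).coord μ (R (finBasis ℝ (S.T x) ν)) •
        LinearMap.lTensor (E x)
          (LinearMap.mulLeft ℝ (ExteriorAlgebra.ι ℝ ((finBasis ℝ (S.T x)).coord ν)) ∘ₗ
            CliffordAlgebra.contractLeft (Dual.eval ℝ (S.T x) (finBasis ℝ (S.T x) μ)))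
          (σ x) := by
  have h : (finBasis ℝ FE).constr ℝ (fun a =>
      DE' (fun y => (trivializationAt FE E x).symmₗ ℝ y (finBasis ℝ FE a)) x X) =
      (finBasis ℝ FE).constr ℝ (fun a =>
        DE (fun y => (trivializationAt FE E x).symmₗ ℝ y (finBasis ℝ FE a)) x X)
      + K ∘ₗ (trivializationAt FE E x).symmₗ ℝ x := by
    refine (finBasis ℝ FE).ext fun a => ?_
    rw [Basis.constr_basis, LinearMap.add_apply, Basis.constr_basis, hE]
    rfl
  have h2 := congrArg (fun L => LinearMap.rTensor (ExteriorAlgebra ℝ (Dual ℝ (S.T x))) L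
    (localRep FE σ x x)) h
  simp only [LinearMap.rTensor_add, LinearMap.rTensor_comp, LinearMap.add_apply,
    LinearMap.comp_apply, rTensor_localRep_self] at h2
  simp only [tensorConn, h2, hT, map_add, add_smul, Finset.sum_add_distrib]
  abel

variable [∀ x, IsTopologicalAddGroup (E x)] [∀ x, ContinuousSMul ℝ (E x)]
  (C : CliffordModule FE E S)

namespace CliffordModule

theorem tensorConn_connE_connT {u : ℝ} (hu : 0 < u) (σ : SmoothSec FE E S) (X : Tan n x) :
    tensorConn FE (C.connE u) (S.connT u) σ.1 x X =
      C.conn0 σ x X + (u⁻¹ / 4) • C.clOmegaF x X (σ.1 x) + (u / 2) • soTDer E S x X (σ.1 x) := by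
  rw [conn0, tensorConn_eq_add (DE := fun s x X => C.conn s x X) (DT := S.connT0)
    (K := (u⁻¹ / 4) • (C.cOmegaF x X).restrictScalars ℝ)
    (R := fun v => (u / 2) • S.soT x X v) (fun s => rfl) (fun v => S.connT_transportT hu v X),
    LinearMap.rTensor_smul, sub_eq_add_neg]
  simp only [map_smul, smul_assoc, ← Finset.smul_sum, soTDer, LinearMap.neg_apply,
    LinearMap.sum_apply, LinearMap.smul_apply, smul_neg]
  rfl

/-- Linearity in the direction `X` is what allows the change of basis in `dirac_eq`. -/
theorem isLinearMap_bismutConn {u : ℝ} (hu : 0 < u) (σ : Π x, Fib E S x) :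
    IsLinearMap ℝ (C.bismutConn u σ x) := by
  have h := isLinearMap_tensorConn (FE := FE) (x := x) (DE := C.connE u) (DT := S.connT u)
    (fun s => ⟨fun X Y => by
        simp only [connE, map_add, C.isLinearMap_cOmegaF.map_add, LinearMap.add_apply, smul_add]
        abel,
      fun r X => by
        simp only [connE, map_smul, C.isLinearMap_cOmegaF.map_smul, LinearMap.smul_apply, smul_add,
          smul_comm r]⟩)
    (fun U => ⟨fun X Y => by simp only [Splitting.connT, map_add],
      fun r X => by simp only [Splitting.connT, map_smul]⟩) σ
  have hω (Y Z) := S.isLinearMap_omega_left hu (x := x) Y Z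
  constructor
  · intro X Y
    simp only [bismutConn, h.map_add, mTwo, (hω _ _).map_add, add_smul, Finset.sum_add_distrib,
      LinearMap.smul_apply, LinearMap.add_apply, smul_add]
    abel
  · intro r X
    simp only [bismutConn, h.map_smul, mTwo, (hω _ _).map_smul, smul_assoc, ← Finset.smul_sum,
      LinearMap.smul_apply, smul_add, smul_comm _ r]

theorem dirac_eq {e : Basis (Fin n₁) ℝ (S.F x)} {f : Basis (Fin n₂) ℝ (S.T x)}
    (hf : ∀ μ ν, S.gT x (f μ) (f ν) = if μ = ν then 1 else 0) {u : ℝ} (hu : 0 < u)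
    (σ : SmoothSec FE E S) : C.dirac u σ x =
      ∑ i, C.cl x (e.coord i) (C.bismutConn u σ.1 x (e i : Tan n x))
        + ∑ μ, (C.eps x (f.coord μ) - u • C.iot x (f μ))
          (C.bismutConn u σ.1 x (f μ : Tan n x)) := by
  have h := Basis.sum_apply_coord (finBasis ℝ (Tan n x)) (S.adaptedBasis e f)
    (B := fun X ξ => C.m u x ξ (C.bismutConn u σ.1 x X))
    (fun ξ => ⟨fun X Y => by rw [(C.isLinearMap_bismutConn hu _).map_add, map_add],
      fun r X => by rw [(C.isLinearMap_bismutConn hu _).map_smul, map_smul]⟩)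
    (fun X => ⟨fun ξ η => by rw [(C.isLinearMap_m u).map_add, LinearMap.add_apply],
      fun r ξ => by rw [(C.isLinearMap_m u).map_smul, LinearMap.smul_apply]⟩)
  refine h.trans ?_
  simp only [Fintype.sum_sum_type, Splitting.adaptedBasis_inl, Splitting.adaptedBasis_inr,
    m_coord_inl, m_coord_inr C hf]

end CliffordModule

end

/-! ### Laurent expansion of the Dirac operator and its finite part. -/

section

variable {n n₁ n₂ : ℕ} {M : Type*} [TopologicalSpace M]
  [ChartedSpace (EuclideanSpace ℝ (Fin n)) M] [IsManifold (𝓡 n) ∞ M]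
  {FE : Type*} [NormedAddCommGroup FE] [NormedSpace ℂ FE]
  {E : M → Type*} [TopologicalSpace (TotalSpace FE E)]
  [∀ x, AddCommGroup (E x)] [∀ x, Module ℂ (E x)] [∀ x, TopologicalSpace (E x)]
  [∀ x, IsTopologicalAddGroup (E x)] [∀ x, ContinuousSMul ℝ (E x)]
  [FiberBundle FE E] [VectorBundle ℝ FE E] {S : Splitting n n₁ n₂ M} {x : M}
  (C : CliffordModule FE E S)

namespace CliffordModule

variable (e : Basis (Fin n₁) ℝ (S.F x)) (f : Basis (Fin n₂) ℝ (S.T x))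

/-- `½ m_u(ι_X ω_u)` for `X = e_j`. -/
def shapeF (u : ℝ) (j : Fin n₁) : Module.End ℝ (Fib E S x) :=
  (1 / 2 : ℝ) • ∑ i, ∑ μ, (1 / 2 * (-S.lieF x (f μ) (e j) (e i)
      + u⁻¹ * S.OmegaF x (f μ : Tan n x) (e i) (e j))) •
    ((C.cl x (e.coord i) : Module.End ℝ (Fib E S x)) *
      ((C.eps x (f.coord μ) : Module.End ℝ (Fib E S x)) - u • C.iot x (f μ)))

/-- `½ m_u(ι_X ω_u)` for `X = f_ν`. -/
def shapeT (u : ℝ) (ν : Fin n₂) : Module.End ℝ (Fib E S x) :=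
  (1 / 2 : ℝ) • ∑ i, ∑ μ, (1 / 2 * (u⁻¹ * S.lieT x (e i) (f ν) (f μ)
      - S.OmegaT x (e i : Tan n x) (f μ) (f ν))) •
    ((C.cl x (e.coord i) : Module.End ℝ (Fib E S x)) *
      ((C.eps x (f.coord μ) : Module.End ℝ (Fib E S x)) - u • C.iot x (f μ)))

variable {e f}

theorem exists_zeroth_order_expansion (he : ∀ i j, S.gF x (e i) (e j) = if i = j then 1 else 0) :
    ∃ B A A' : Module.End ℝ (Fib E S x), ∀ u : ℝ, 0 < u →
      ∑ j, (C.cl x (e.coord j) : Module.End ℝ (Fib E S x)) * C.shapeF e f u j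
        + ∑ ν, ((C.eps x (f.coord ν) : Module.End ℝ (Fib E S x)) - u • C.iot x (f ν)) *
          ((u⁻¹ / 4) • C.clOmegaF x (f ν : Tan n x) + C.shapeT e f u ν) =
      u⁻¹ • B + ((1 / 4 : ℝ) • C.iotaOmegaF e f + (1 / 4 : ℝ) • C.epsTrLgF e f
        - (1 / 2 : ℝ) • C.clEpsOmegaT e f + (1 / 4 : ℝ) • C.clTrLgT e f) + u • A + u ^ 2 • A' := by
  classical
  -- The coefficients are read off from the algebraic expansion by unification. They are fixed
  -- before `u`, so they cannot depend on it.
  refine ⟨_, _, _, fun u hu => clifford_expansion (A := Module.End ℝ (Fib E S x))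
    (c := fun i => C.cl x (e.coord i)) (ε := fun μ => C.eps x (f.coord μ))
    (ι := fun μ => C.iot x (f μ)) (LF := fun μ i j => S.lieF x (f μ) (e i) (e j))
    (WF := fun μ i j => S.OmegaF x (f μ : Tan n x) (e i) (e j))
    (LT := fun i μ ν => S.lieT x (e i) (f μ) (f ν))
    (WT := fun i μ ν => S.OmegaT x (e i : Tan n x) (f μ) (f ν))
    (O := fun μ => C.clOmegaF x (f μ : Tan n x)) hu.ne'
    (C.cl_coord_mul_cl_coord he) (fun i μ => C.cl_mul_eps _ _) (fun i μ => C.cl_mul_iot _ _)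
    (fun μ ν => C.eps_mul_eps _ _) (fun μ ν => C.iot_mul_iot _ _) (fun μ ν => (C.eps_mul_iot _ _).trans (congrArg (· • _) ?_))
    (fun μ i j => S.lieF_symm _ _ _) (fun μ i j => S.OmegaF_swap _ _ _)
    (fun i μ ν => S.lieT_symm _ _ _) (fun i μ ν => S.OmegaT_swap _ _ _)
    (fun μ => C.clOmegaF_eq e _)⟩
  rw [Basis.coord_apply, Basis.repr_self, Finsupp.single_apply]
  simp only [eq_comm]

variable [FiniteDimensional ℂ FE]

theorem bismutConn_coe_F (hf : ∀ μ ν, S.gT x (f μ) (f ν) = if μ = ν then 1 else 0) {u : ℝ}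
    (hu : 0 < u) (σ : SmoothSec FE E S) (j : Fin n₁) :
    C.bismutConn u σ.1 x (e j : Tan n x) = C.conn0 σ x (e j : Tan n x)
      + (u / 2) • soTDer E S x (e j : Tan n x) (σ.1 x) + C.shapeF e f u j (σ.1 x) := by
  have h : (1 / 2 : ℝ) • (C.mTwo u x (S.omega u x (e j : Tan n x)) : Module.End ℝ (Fib E S x)) =
      C.shapeF e f u j := by
    rw [mTwo_omega C (e := e) hf hu, shapeF]
    simp only [S.omega_F_F_T hu]
  have h1 : (1 / 2 : ℝ) • C.mTwo u x (S.omega u x (e j : Tan n x)) (σ.1 x) =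
      C.shapeF e f u j (σ.1 x) := LinearMap.congr_fun h (σ.1 x)
  have h2 : C.clOmegaF x (e j : Tan n x) (σ.1 x) = 0 :=
    LinearMap.congr_fun (C.clOmegaF_coe_F (e j)) (σ.1 x)
  rw [bismutConn, C.tensorConn_connE_connT hu]
  linear_combination (norm := module) h1 + (u⁻¹ / 4) • h2

theorem bismutConn_coe_T (hf : ∀ μ ν, S.gT x (f μ) (f ν) = if μ = ν then 1 else 0) {u : ℝ}
    (hu : 0 < u) (σ : SmoothSec FE E S) (ν : Fin n₂) :
    C.bismutConn u σ.1 x (f ν : Tan n x) = C.conn0 σ x (f ν : Tan n x)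
      + ((u⁻¹ / 4) • C.clOmegaF x (f ν : Tan n x) + C.shapeT e f u ν) (σ.1 x) := by
  have h : (1 / 2 : ℝ) • (C.mTwo u x (S.omega u x (f ν : Tan n x)) : Module.End ℝ (Fib E S x)) =
      C.shapeT e f u ν := by
    rw [mTwo_omega C (e := e) hf hu, shapeT]
    simp only [S.omega_T_F_T hu]
  have h1 : (1 / 2 : ℝ) • C.mTwo u x (S.omega u x (f ν : Tan n x)) (σ.1 x) =
      C.shapeT e f u ν (σ.1 x) := LinearMap.congr_fun h (σ.1 x)
  have h2 : soTDer E S x (f ν : Tan n x) (σ.1 x) = 0 :=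
    LinearMap.congr_fun (soTDer_coe_T (f ν)) (σ.1 x)
  change _ = C.conn0 σ x (f ν : Tan n x)
    + ((u⁻¹ / 4) • C.clOmegaF x (f ν : Tan n x) (σ.1 x) + C.shapeT e f u ν (σ.1 x))
  rw [bismutConn, C.tensorConn_connE_connT hu]
  linear_combination (norm := module) h1 + (u / 2) • h2

theorem exists_dirac_expansion (he : ∀ i j, S.gF x (e i) (e j) = if i = j then 1 else 0)
    (hf : ∀ μ ν, S.gT x (f μ) (f ν) = if μ = ν then 1 else 0) (σ : SmoothSec FE E S) :
    ∃ B A A' : Fib E S x, ∀ u : ℝ, 0 < u → C.dirac u σ x = u⁻¹ • B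
      + (C.horizontalDirac e σ + C.transverseD f σ
          + (1 / 4 : ℝ) • C.iotaOmegaF e f (σ.1 x)
          + (1 / 4 : ℝ) • C.epsTrLgF e f (σ.1 x)
          - (1 / 2 : ℝ) • C.clEpsOmegaT e f (σ.1 x)
          + (1 / 4 : ℝ) • C.clTrLgT e f (σ.1 x)) + u • A + u ^ 2 • A' := by
  obtain ⟨B, A, A', h⟩ := C.exists_zeroth_order_expansion (f := f) he
  -- Two contributions of order `u` come from outside the endomorphism part: the (u/2) 𝔰𝔬Ω_𝒯
  -- correction of ∇^{𝒯,u} under c, and the term -uι of the Clifford action applied to the `u`-free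
  -- connection.
  refine ⟨B (σ.1 x), A (σ.1 x)
    + (1 / 2 : ℝ) • ∑ j, C.cl x (e.coord j) (soTDer E S x (e j : Tan n x) (σ.1 x))
    - ∑ ν, C.iot x (f ν) (C.conn0 σ x (f ν : Tan n x)), A' (σ.1 x), fun u hu => ?_⟩
  have h' := LinearMap.congr_fun (h u hu) (σ.1 x)
  simp only [LinearMap.add_apply, LinearMap.sub_apply, LinearMap.smul_apply, LinearMap.sum_apply,
    Module.End.mul_apply, map_add] at h'
  rw [C.dirac_eq (e := e) hf hu]
  simp only [C.bismutConn_coe_F hf hu, C.bismutConn_coe_T (e := e) hf hu, horizontalDirac,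
    transverseD, map_add, map_smul, LinearMap.add_apply, LinearMap.sub_apply,
    LinearMap.smul_apply, Finset.sum_add_distrib, Finset.sum_sub_distrib, ← Finset.smul_sum] at h' ⊢
  linear_combination (norm := module) h'

end CliffordModule

theorem hasFinitePart_of_expansion {Γ M : Type*} {V : M → Type*} [∀ x, AddCommGroup (V x)]
    [∀ x, Module ℝ (V x)] {A : ℝ → Γ → Π x, V x} {L : Γ → Π x, V x}
    (h : ∀ σ x, ∃ B A₁ A₂ : V x, ∀ u : ℝ, 0 < u →
      A u σ x = u⁻¹ • B + L σ x + u • A₁ + u ^ 2 • A₂) : HasFinitePart A L := by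
  choose B A₁ A₂ h using h
  -- A single subtraction suffices: the index 0 of `Fin 1` corresponds to the power u⁻¹.
  refine ⟨1, fun _ => B, fun σ x l => ?_⟩
  have h1 : Tendsto (fun u : ℝ => l (L σ x) + u * l (A₁ σ x) + u ^ 2 * l (A₂ σ x)) (𝓝[>] 0)
      (𝓝 (l (L σ x))) := by
    have hc : Continuous fun u : ℝ => l (L σ x) + u * l (A₁ σ x) + u ^ 2 * l (A₂ σ x) := by
      fun_prop
    simpa using (hc.tendsto 0).mono_left nhdsWithin_le_nhds
  refine h1.congr' ?_
  filter_upwards [self_mem_nhdsWithin] with u hu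
  rw [h σ x u hu]
  simp only [Finset.univ_unique, Fin.default_eq_zero, Fin.val_zero, zero_add, pow_one,
    Finset.sum_singleton, map_sub, map_add, map_smul, smul_eq_mul]
  ring

end

end AsymptoticBismut

end

theorem mainTheorem11 {n n₁ n₂ : ℕ} {M : Type*} [TopologicalSpace M] [T2Space M]
    [SecondCountableTopology M] [ChartedSpace (EuclideanSpace ℝ (Fin n)) M] [IsManifold (𝓡 n) ∞ M]
    (S : AsymptoticBismut.Splitting n n₁ n₂ M)
    {FE : Type*} [NormedAddCommGroup FE] [NormedSpace ℂ FE] [FiniteDimensional ℂ FE]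
    {E : M → Type*} [TopologicalSpace (TotalSpace FE E)]
    [∀ x, AddCommGroup (E x)] [∀ x, Module ℂ (E x)] [∀ x, TopologicalSpace (E x)]
    [∀ x, IsTopologicalAddGroup (E x)] [∀ x, ContinuousSMul ℝ (E x)]
    [FiberBundle FE E] [VectorBundle ℂ FE E] [VectorBundle ℝ FE E]
    [ContMDiffVectorBundle ∞ FE E (𝓡 n)]
    (C : AsymptoticBismut.CliffordModule FE E S)
    (e : ∀ x, Module.Basis (Fin n₁) ℝ (S.F x))
    (he : ∀ x i j, S.gF x (e x i) (e x j) = if i = j then 1 else 0)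
    (f : ∀ x, Module.Basis (Fin n₂) ℝ (S.T x))
    (hf : ∀ x μ ν, S.gT x (f x μ) (f x ν) = if μ = ν then 1 else 0) :
    AsymptoticBismut.HasFinitePart (V := AsymptoticBismut.Fib E S) C.dirac
      (fun σ x =>
        C.horizontalDirac (e x) σ + C.transverseD (f x) σ
          + (1 / 4 : ℝ) • C.iotaOmegaF (e x) (f x) (σ.1 x)
          + (1 / 4 : ℝ) • C.epsTrLgF (e x) (f x) (σ.1 x)
          - (1 / 2 : ℝ) • C.clEpsOmegaT (e x) (f x) (σ.1 x)
          + (1 / 4 : ℝ) • C.clTrLgT (e x) (f x) (σ.1 x)) :=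
  AsymptoticBismut.hasFinitePart_of_expansion fun σ x =>
    C.exists_dirac_expansion (he x) (hf x) σ
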